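/- **Setting.** There are $M\ge 1$ submodels of $L$ symbols each over a finite field $\mathbb F_q$, stored in $N$ databases that do not collude. Database $n$ may hold $\mu(n)ML$ symbols, where $0\le\mu(n)\le 1$ are arbitrary real numbers, not all zero. $S_n^{[t]}$ is the content of database $n$ after round $t$. $W_{1:M}^{[t]}$ are the submodels that the $N$ contents at time $t$ jointly represent (via a fixed map, and $W^{[0]}$ are the given submodels). In round $t$ a user picks an index $\theta^{[t]}$ and sends queries $Q_n^{[t]}$, which depend on $\theta^{[t]}$ and fresh randomness. It downloads answers $A_n^{[t]}$, each a function of $S_n^{[t-1]}$ and $Q_n^{[t]}$. It then generates an update $\Delta_\theta^{[t]}\in\mathbb F_q^L$ and uploads $U_n^{[t]}$, which may depend on the index, the fresh randomness, the answers and the update. Database $n$ computes $S_n^{[t]}$ from $S_n^{[t-1]},Q_n^{[t]},U_n^{[t]}$. A storage mechanism (the initial encoding, which may use random noise, and the representing map) together with a PRUW scheme (the functions above) has to satisfy the following for every $n$, every number of rounds and every joint law of the initial submodels, the indices and the updates (the randomness of storage and users being independent of these): * $I(\theta^{[t]};Q_n^{[t]},U_n^{[t]}\mid Q_n^{[1:t-1]},S_n^{[0:t-1]},U_n^{[1:t-1]})=0$;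 * $I(\Delta_\theta^{[t]};U_n^{[t]}\mid Q_n^{[1:t]},S_n^{[0:t-1]},U_n^{[1:t-1]})=0$; * $I(W_{1:M}^{[t]};S_n^{[t]})=0$; * $H(W_{\theta^{[t]}}^{[t-1]}\mid Q_{1:N}^{[t]},A_{1:N}^{[t]})=0$; * $W_m^{[t]}=W_m^{[t-1]}+\Delta_\theta^{[t]}$ if $m=\theta^{[t]}$, and $W_m^{[t]}=W_m^{[t-1]}$ otherwise. The total cost is (number of downloaded answer symbols + number of uploaded update symbols in a round)$/L$. A database holding $\ell_n$ symbols is *full* if $H(S_n^{[t]})=\ell_n$ (in $q$-ary units) at all times. **Parameters.** Let $k=1/\max_n\mu(n)$, $p=\sum_n\mu(n)$, $r=kp$, $s=\lfloor k\rfloor p$, and for integers $a,b$ let $$C_T(a,b)=\begin{cases}\frac{4b}{b-a-1},& b-a\ge 3\text{ odd}\\ \frac{4b-2}{b-a-2},& b-a\ge 4\text{ even}\\ \infty,& b-a\le 2.\end{cases}$$ Put ($0\cdot\infty=0$, and a quotient with denominator $0$ is read as $0$) $$C_1=(1-s+\lfloor s\rfloor)\,C_T(\lfloor k\rfloor,\lfloor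 s\rfloor)+(s-\lfloor s\rfloor)\,C_T(\lfloor k\rfloor,\lceil s\rceil),$$ $$C_2=\alpha\beta C_T(\lfloor k\rfloor,\lfloor r\rfloor)+\alpha(1-\beta)C_T(\lfloor k\rfloor,\lceil r\rceil)+(1-\alpha)\delta C_T(\lceil k\rceil,\lfloor r\rfloor)+(1-\alpha)(1-\delta)C_T(\lceil k\rceil,\lceil r\rceil),$$ where, if $\lfloor r\rfloor-\lfloor k\rfloor$ is odd, * $\alpha=\frac{\lfloor k\rfloor(p\lceil k\rceil-\lceil r\rceil)}{\lceil k\rceil\lfloor r\rfloor-\lfloor k\rfloor\lceil r\rceil}$ if $r-\lfloor r\rfloor>k-\lfloor k\rfloor$ and $s\le\lfloor r\rfloor$, and $\alpha=\frac{\lfloor k\rfloor}{k}(\lceil k\rceil-k)$ otherwise; * $\beta=\frac{\lceil r\rceil-r}{\lceil k\rceil-k}$ if $r-\lfloor r\rfloor>k-\lfloor k\rfloor$ and $s>\lfloor r\rfloor$, and $\beta=1$ otherwise; * $\delta=1-\frac{r-\lfloor r\rfloor}{k-\lfloor k\rfloor}$ if $r-\lfloor r\rfloor\le k-\lfloor k\rfloor$,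 and $\delta=0$ otherwise; and, if $\lfloor r\rfloor-\lfloor k\rfloor$ is even, $\delta=1$ and * $\alpha=\frac{\lfloor k\rfloor}{k}(\lceil k\rceil-k)$, $\beta=1-\frac{r-\lfloor r\rfloor}{\lceil k\rceil-k}$ if $r-\lfloor r\rfloor<\lceil k\rceil-k$; * $\alpha=\frac{\lfloor k\rfloor(p\lceil k\rceil-\lfloor r\rfloor)}{\lceil k\rceil\lceil r\rceil-\lfloor k\rfloor\lfloor r\rfloor}$, $\beta=0$ otherwise. **Theorem.** Let $\mathcal C=\min\{C_1,C_2\}$ and suppose $\mathcal C<\infty$. There is $q_0$, depending only on $N$ and $\mu$, such that: 1. if all $\mu(n)$ are rational, there is $L_0\ge1$ (depending only on $N,\mu$) such that for every finite field with $q\ge q_0$ elements, every $M\ge1$ and every positive multiple $L$ of $L_0$ there are a storage mechanism and a PRUW scheme, satisfying all the requirements above, for which every database is full with exactly $\mu(n)ML$ symbols and the total cost is exactly $\mathcal C$; 2. for arbitrary real $\mu(n)$ and every $\varepsilon>0$ there is $L_0$ (depending only on $N,\mu,\varepsilon$) such that for every finite field with $q\ge q_0$ elements, every $M\ge1$ and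 every $L\ge L_0$ there are a storage mechanism and a PRUW scheme, satisfying all the requirements above, for which every database is full with a number of symbols that differs from $\mu(n)ML$ by at most $\varepsilon ML$, and the total cost differs from $\mathcal C$ by at most $\varepsilon$. -/

import Mathlib

open scoped ENNReal

noncomputable section

namespace PRUW

/-! ### Shannon quantities of random variables on a finite probability space

`entropy q P X` is measured in `q`-ary units, so that one uniform symbol of `𝔽_q` has entropy one.
Random variables take values in finite types. -/

/-- `H(X)` -/
def entropy (q : ℕ) {Ω α : Type*} [Fintype α] (P : PMF Ω) (X : Ω → α) : ℝ :=
  ∑ x : α, Real.negMulLog ((P.map X) x).toReal / Real.log q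

/-- `H(X | Y)` -/
def condEntropy (q : ℕ) {Ω α β : Type*} [Fintype α] [Fintype β] (P : PMF Ω)
    (X : Ω → α) (Y : Ω → β) : ℝ :=
  entropy q P (fun ω => (X ω, Y ω)) - entropy q P Y

/-- `I(X ; Y)` -/
def mutualInfo (q : ℕ) {Ω α β : Type*} [Fintype α] [Fintype β] (P : PMF Ω)
    (X : Ω → α) (Y : Ω → β) : ℝ :=
  entropy q P X - condEntropy q P X Y

/-- `I(X ; Y | Z)` -/
def condMutualInfo (q : ℕ) {Ω α β γ : Type*} [Fintype α] [Fintype β] [Fintype γ] (P : PMF Ω)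
    (X : Ω → α) (Y : Ω → β) (Z : Ω → γ) : ℝ :=
  condEntropy q P X Z - condEntropy q P X (fun ω => (Y ω, Z ω))

/-! ### Storage mechanisms and PRUW schemes -/

/-- The values of all submodels: `M` submodels with `L` parameters each. -/
abbrev Models (F : Type*) (M L : ℕ) : Type _ := Fin M → Fin L → F

/-- A storage mechanism for `M` submodels of `L` symbols in `N` databases: database `n` holds
`storeLen n` symbols, computed at time `0` from the submodels and from uniform storage noise, and
`recover` tells which submodels the contents of all databases represent. -/
structure StorageMechanism (F : Type*) (N M L : ℕ) where
  /-- number of symbols held by each database -/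
  storeLen : Fin N → ℕ
  /-- number of storage noise symbols -/
  storeNoiseLen : ℕ
  /-- initial contents of the databases -/
  init : Models F M L → (Fin storeNoiseLen → F) → (n : Fin N) → Fin (storeLen n) → F
  /-- the submodels represented by the joint contents of the databases -/
  recover : ((n : Fin N) → Fin (storeLen n) → F) → Models F M L

/-- A PRUW scheme on top of a storage mechanism. In each round the user, who holds fresh uniform
noise, sends queries (before the update values exist), downloads answers, and uploads updates;
each database acts on what it has stored and received itself. -/
structure Scheme (F : Type*) (N M L : ℕ) extends StorageMechanism F N M L where
  /-- number of noise symbols that a user draws in one round -/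
  userNoiseLen : ℕ
  /-- number of symbols of the query sent to each database -/
  queryLen : Fin N → ℕ
  /-- number of symbols downloaded from each database in the reading phase -/
  answerLen : Fin N → ℕ
  /-- number of symbols uploaded to each database in the writing phase -/
  updateLen : Fin N → ℕ
  /-- the queries, from the submodel index and the noise of the user -/
  query : Fin M → (Fin userNoiseLen → F) → (n : Fin N) → Fin (queryLen n) → F
  /-- the answer of a database, from its contents and its query -/
  answer : (n : Fin N) → (Fin (storeLen n) → F) → (Fin (queryLen n) → F) →
    Fin (answerLen n) → F
  /-- the uploads, from the index, the noise, all downloaded answers and the update values -/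
  upload : Fin M → (Fin userNoiseLen → F) → ((n : Fin N) → Fin (answerLen n) → F) →
    (Fin L → F) → (n : Fin N) → Fin (updateLen n) → F
  /-- new contents of a database, from its old contents, its query and its upload -/
  refresh : (n : Fin N) → (Fin (storeLen n) → F) → (Fin (queryLen n) → F) →
    (Fin (updateLen n) → F) → Fin (storeLen n) → F

/-- What happens outside the scheme during `T` rounds: the initial submodels, the submodel index
chosen in each round and the update values generated in each round. -/
structure Source (F : Type*) (M L T : ℕ) where
  /-- initial submodels -/
  models : Models F M L
  /-- updating submodel index in each round -/
  index : Fin T → Fin M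
  /-- update values in each round -/
  delta : Fin T → Fin L → F

namespace Scheme

variable {F : Type*} {N M L : ℕ} (σ : Scheme F N M L)

/-- Reading cost: downloaded symbols per parameter of a submodel. -/
def readingCost : ℝ := (∑ n, (σ.answerLen n : ℝ)) / L

/-- Writing cost: uploaded symbols per parameter of a submodel. -/
def writingCost : ℝ := (∑ n, (σ.updateLen n : ℝ)) / L

/-- Total cost. -/
def totalCost : ℝ := σ.readingCost + σ.writingCost

/-- The noise used in `T` rounds: the storage noise and the noise of the user of each round. -/
abbrev Noise (T : ℕ) : Type _ :=
  (Fin σ.storeNoiseLen → F) × (Fin T → Fin σ.userNoiseLen → F)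

/-- The outcomes of `T` rounds. -/
abbrev Outcome (T : ℕ) : Type _ := Source F M L T × σ.Noise T

/-- The law of an outcome: the source has an arbitrary law (indices and updates may depend on each
other and on the submodels), and all noise symbols are uniform and independent of each other and
of the source. -/
def law [Fintype F] [Nonempty F] {T : ℕ} (prior : PMF (Source F M L T)) : PMF (σ.Outcome T) :=
  prior.bind fun x => (PMF.uniformOfFintype (σ.Noise T)).map fun z => (x, z)

variable {T : ℕ}

/-- `θ^{[t+1]}` -/
def theta (t : Fin T) (ω : σ.Outcome T) : Fin M := ω.1.index t

/-- `Δ_θ^{[t+1]}` -/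
def delta (t : Fin T) (ω : σ.Outcome T) : Fin L → F := ω.1.delta t

/-- `Q_n^{[t+1]}` -/
def Q (t : Fin T) (n : Fin N) (ω : σ.Outcome T) : Fin (σ.queryLen n) → F :=
  σ.query (ω.1.index t) (ω.2.2 t) n

/-- The answers that are given in round `t` if the contents of the databases are `s`. -/
def answersFrom (t : Fin T) (s : (n : Fin N) → Fin (σ.storeLen n) → F) (ω : σ.Outcome T)
    (n : Fin N) : Fin (σ.answerLen n) → F :=
  σ.answer n (s n) (σ.Q t n ω)

/-- The uploads that are made in round `t` if the contents of the databases are `s`. -/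
def uploadsFrom (t : Fin T) (s : (n : Fin N) → Fin (σ.storeLen n) → F) (ω : σ.Outcome T)
    (n : Fin N) : Fin (σ.updateLen n) → F :=
  σ.upload (ω.1.index t) (ω.2.2 t) (σ.answersFrom t s ω) (ω.1.delta t) n

/-- `S_{1:N}^{[t]}`: the contents of the databases after `t` rounds. -/
def S (ω : σ.Outcome T) (t : Fin (T + 1)) : (n : Fin N) → Fin (σ.storeLen n) → F :=
  Fin.induction (motive := fun _ => (n : Fin N) → Fin (σ.storeLen n) → F)
    (σ.init ω.1.models ω.2.1)
    (fun t s n => σ.refresh n (s n) (σ.Q t n ω) (σ.uploadsFrom t s ω n)) t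

/-- `A_n^{[t+1]}` -/
def A (t : Fin T) (n : Fin N) (ω : σ.Outcome T) : Fin (σ.answerLen n) → F :=
  σ.answersFrom t (σ.S ω t.castSucc) ω n

/-- `U_n^{[t+1]}` -/
def U (t : Fin T) (n : Fin N) (ω : σ.Outcome T) : Fin (σ.updateLen n) → F :=
  σ.uploadsFrom t (σ.S ω t.castSucc) ω n

/-- `W_{1:M}^{[t]}`: the submodels represented by the databases after `t` rounds. -/
def W (t : Fin (T + 1)) (ω : σ.Outcome T) : Models F M L := σ.recover (σ.S ω t)

/-- `Q_n^{[1:t]}` -/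
def pastQ (t : Fin T) (n : Fin N) (ω : σ.Outcome T) :
    {i : Fin T // i < t} → Fin (σ.queryLen n) → F := fun i => σ.Q i n ω

/-- `U_n^{[1:t]}` -/
def pastU (t : Fin T) (n : Fin N) (ω : σ.Outcome T) :
    {i : Fin T // i < t} → Fin (σ.updateLen n) → F := fun i => σ.U i n ω

/-- `S_n^{[0:t]}` -/
def pastS (t : Fin T) (n : Fin N) (ω : σ.Outcome T) :
    {i : Fin (T + 1) // i ≤ t.castSucc} → Fin (σ.storeLen n) → F := fun i => σ.S ω i n

/-- The requirements on a storage mechanism with a PRUW scheme, for every number of rounds and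
every law of the source. -/
structure IsValid [Fintype F] [Field F] : Prop where
  /-- `I(θ^{[t]} ; Q_n^{[t]}, U_n^{[t]} | Q_n^{[1:t-1]}, S_n^{[0:t-1]}, U_n^{[1:t-1]}) = 0` -/
  index_privacy : ∀ (T : ℕ) (prior : PMF (Source F M L T)) (t : Fin T) (n : Fin N),
    condMutualInfo (Fintype.card F) (σ.law prior) (σ.theta t)
      (fun ω => (σ.Q t n ω, σ.U t n ω))
      (fun ω => (σ.pastQ t n ω, σ.pastS t n ω, σ.pastU t n ω)) = 0
  /-- `I(Δ_θ^{[t]} ; U_n^{[t]} | Q_n^{[1:t]}, S_n^{[0:t-1]}, U_n^{[1:t-1]}) = 0` -/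
  update_privacy : ∀ (T : ℕ) (prior : PMF (Source F M L T)) (t : Fin T) (n : Fin N),
    condMutualInfo (Fintype.card F) (σ.law prior) (σ.delta t) (σ.U t n)
      (fun ω => ((σ.pastQ t n ω, σ.Q t n ω), σ.pastS t n ω, σ.pastU t n ω)) = 0
  /-- `I(W_{1:M}^{[t]} ; S_n^{[t]}) = 0` -/
  security : ∀ (T : ℕ) (prior : PMF (Source F M L T)) (t : Fin (T + 1)) (n : Fin N),
    mutualInfo (Fintype.card F) (σ.law prior) (σ.W t) (fun ω => σ.S ω t n) = 0
  /-- `H(W_θ^{[t-1]} | Q_{1:N}^{[t]}, A_{1:N}^{[t]}) = 0` -/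
  read_correct : ∀ (T : ℕ) (prior : PMF (Source F M L T)) (t : Fin T),
    condEntropy (Fintype.card F) (σ.law prior) (fun ω => σ.W t.castSucc ω (σ.theta t ω))
      (fun ω => ((fun n => σ.Q t n ω), (fun n => σ.A t n ω))) = 0
  /-- the databases initially represent the given submodels -/
  init_correct : ∀ (T : ℕ) (ω : σ.Outcome T), σ.W 0 ω = ω.1.models
  /-- `W_m^{[t]} = W_m^{[t-1]} + Δ_m^{[t]}` if `m = θ^{[t]}`, and `W_m^{[t]} = W_m^{[t-1]}` else -/
  write_correct : ∀ (T : ℕ) (ω : σ.Outcome T) (t : Fin T) (m : Fin M),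
    σ.W t.succ ω m =
      if m = σ.theta t ω then σ.W t.castSucc ω m + σ.delta t ω else σ.W t.castSucc ω m

/-- At every time the content of each database has the full entropy of the symbols it consists
of, `H(S_n^{[t]}) = storeLen n`: no stored symbol is idle or redundant within its database. -/
def IsFull [Fintype F] [Nonempty F] : Prop :=
  ∀ (T : ℕ) (prior : PMF (Source F M L T)) (t : Fin (T + 1)) (n : Fin N),
    entropy (Fintype.card F) (σ.law prior) (fun ω => σ.S ω t n) = σ.storeLen n

end Scheme

/-! ### The cost -/

/-- The cost `C_T(a,b)` of an `(a,b)` MDS code. It is infinite when the denominator of the formula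
is not positive, that is, for `b - a ≤ 2`: no such code is available. -/
def CT (a b : ℕ) : ℝ≥0∞ :=
  if a + 3 ≤ b then
    if Odd (b - a) then ENNReal.ofReal (4 * (b : ℝ) / ((b : ℝ) - a - 1))
    else ENNReal.ofReal ((4 * (b : ℝ) - 2) / ((b : ℝ) - a - 2))
  else ⊤

section Params

variable {N : ℕ} (μ : Fin N → ℝ)

/-- `k = 1 / max μ(n)` -/
def kk : ℝ := 1 / ⨆ n, μ n

/-- `p = ∑ μ(n)` -/
def pp : ℝ := ∑ n, μ n

/-- `r = k p` -/
def rr : ℝ := kk μ * pp μ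

/-- `s = ⌊k⌋ p` -/
def ss : ℝ := ⌊kk μ⌋₊ * pp μ

/-- `⌊r⌋ - ⌊k⌋` is odd -/
def OddCase : Prop := Odd ((⌊rr μ⌋₊ : ℤ) - ⌊kk μ⌋₊)

open Classical in
/-- the weight `α` -/
def alphaW : ℝ :=
  if OddCase μ then
    if rr μ - ⌊rr μ⌋₊ > kk μ - ⌊kk μ⌋₊ ∧ ss μ ≤ ⌊rr μ⌋₊ then
      ⌊kk μ⌋₊ * (pp μ * ⌈kk μ⌉₊ - ⌈rr μ⌉₊) /
        ((⌈kk μ⌉₊ : ℝ) * ⌊rr μ⌋₊ - ⌊kk μ⌋₊ * ⌈rr μ⌉₊)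
    else ⌊kk μ⌋₊ / kk μ * (⌈kk μ⌉₊ - kk μ)
  else
    if rr μ - ⌊rr μ⌋₊ < ⌈kk μ⌉₊ - kk μ then
      ⌊kk μ⌋₊ / kk μ * (⌈kk μ⌉₊ - kk μ)
    else
      ⌊kk μ⌋₊ * (pp μ * ⌈kk μ⌉₊ - ⌊rr μ⌋₊) /
        ((⌈kk μ⌉₊ : ℝ) * ⌈rr μ⌉₊ - ⌊kk μ⌋₊ * ⌊rr μ⌋₊)

open Classical in
/-- the weight `β` -/
def betaW : ℝ :=
  if OddCase μ then
    if rr μ - ⌊rr μ⌋₊ > kk μ - ⌊kk μ⌋₊ ∧ ss μ > ⌊rr μ⌋₊ then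
      (⌈rr μ⌉₊ - rr μ) / (⌈kk μ⌉₊ - kk μ)
    else 1
  else
    if rr μ - ⌊rr μ⌋₊ < ⌈kk μ⌉₊ - kk μ then
      1 - (rr μ - ⌊rr μ⌋₊) / (⌈kk μ⌉₊ - kk μ)
    else 0

open Classical in
/-- the weight `δ` -/
def deltaW : ℝ :=
  if OddCase μ then
    if rr μ - ⌊rr μ⌋₊ ≤ kk μ - ⌊kk μ⌋₊ then
      1 - (rr μ - ⌊rr μ⌋₊) / (kk μ - ⌊kk μ⌋₊)
    else 0
  else 1

/-- `C₁`; the weight of `(⌊k⌋, ⌊s⌋)` is `⌈s⌉ - s` for non-integral `s` and `1` for integral `s`. -/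
def C₁ : ℝ≥0∞ :=
  ENNReal.ofReal (1 - (ss μ - ⌊ss μ⌋₊)) * CT ⌊kk μ⌋₊ ⌊ss μ⌋₊ +
    ENNReal.ofReal (ss μ - ⌊ss μ⌋₊) * CT ⌊kk μ⌋₊ ⌈ss μ⌉₊

/-- `C₂` -/
def C₂ : ℝ≥0∞ :=
  ENNReal.ofReal (alphaW μ * betaW μ) * CT ⌊kk μ⌋₊ ⌊rr μ⌋₊ +
    ENNReal.ofReal (alphaW μ * (1 - betaW μ)) * CT ⌊kk μ⌋₊ ⌈rr μ⌉₊ +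
    ENNReal.ofReal ((1 - alphaW μ) * deltaW μ) * CT ⌈kk μ⌉₊ ⌊rr μ⌋₊ +
    ENNReal.ofReal ((1 - alphaW μ) * (1 - deltaW μ)) * CT ⌈kk μ⌉₊ ⌈rr μ⌉₊

/-- `C = min {C₁, C₂}` -/
def Cmin : ℝ≥0∞ := min (C₁ μ) (C₂ μ)

end Params

end PRUW

end

/-!
A scheme that costs no more than `C` is built directly, and arrays that are longer than this scheme
needs are filled up: unused places of the contents with independent noise, unused places of the
messages with zeros. So it suffices to bound the storage and the cost from above.

**The code.** A part consists of `ℓ` chunks of `a` symbols of each submodel and uses `a + 2 * ℓ`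
databases. A database stores one symbol per chunk, the value at its own point `α` of a polynomial of
degree less than `a + ℓ` whose values at `a` further points `f i j` are the symbols of the chunk.
The share `[m = θ] + (α - f i j) * r` of the indicator of `θ` is uniform and has degree one in `α`.
In reading, the products of contents and shares are summed over all submodels and over the chunks,
with Lagrange basis polynomials over the chunks as coefficients; the sum has degree less than
`a + 2 * ℓ`, so the answers determine it, and with it one symbol of each chunk of submodel `θ`
(`Layout.decodeReply_reply`). In writing, one combined symbol per `j` carries the update of all
chunks. It is protected by a one-time pad; the effect of the pad on the contents is cancelled by a
mask which was sent with the queries and is itself hidden by a noise multiple of the polynomial that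
vanishes at the points of the chunk. As the pad costs no degree, the increments have degree less
than `a + ℓ` (`Layout.exists_poly_increment`), and `a + 2 * ℓ` databases suffice, with a cost of
`2 * (a + 2 * ℓ) / ℓ`. For `b = a + 2 * ℓ` this equals `C_T (a - 1, b)` and is less than `C_T (a, b + 1)` and `C_T (a, b)`.

**Privacy.** For every database any two sources are matched by a permutation of the noise that
preserves all it ever sees (`Scheme.IsMasked.exists_noise_equiv`). Hence under every prior its view
is independent of the source, which gives the three information-theoretic requirements, and a
permutation that shifts the contents shows that they are uniform (`Scheme.IsMasked.isValid`,
`Scheme.IsMasked.isFull`).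

**Time sharing.** A vector with entries in `[0, 1]` is a convex combination of indicator vectors of
sets whose sizes are the two integers next to its sum (`isMixture_of_sum_mem_Icc`). It serves as a
storage profile for codes with a single parameter `a`, whose cost is interpolated linearly at the
sum. The profile `⌊k⌋ μ` with `a = ⌊k⌋` costs at most `C₁`. The profile `k μ` with `a = ⌊k⌋ + 1` has
sum `r` and costs at most `C₂`. If `⌊r⌋ - ⌊k⌋` is odd, the code `(⌊k⌋ + 1, ⌊r⌋)` is at least as cheap
as all four codes in `C₂`. Otherwise it is at least as cheap as `(⌊k⌋, ⌊r⌋)` and `(⌈k⌉, ⌊r⌋)`; the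
code `(⌊k⌋, ⌈r⌉)` is matched by `(⌊k⌋ + 1, ⌈r⌉)` and has at most the fractional part of `r` as weight
in `C₂`, and the fourth code does not occur (`exists_profile`).
All weights lie in the field generated by the `μ n`, so for rational `μ` all numbers of parts are integers for suitable `L`; in general they are rounded up.
-/

namespace PRUW

/-! ### Entropy and independence -/

theorem map_apply_of_injective {α β : Type*} (p : PMF α) {f : α → β}
    (hf : Function.Injective f) (a : α) : (p.map f) (f a) = p a := by
  rw [PMF.map_apply, tsum_eq_single a]
  · simp
  · intro b hb
    rw [if_neg]
    exact fun h => hb (hf h).symm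

theorem sum_toReal_eq_one {α : Type*} [Fintype α] (p : PMF α) : ∑ a, (p a).toReal = 1 := by
  have h := p.tsum_coe
  rw [tsum_fintype] at h
  rw [← ENNReal.toReal_sum (fun a _ => p.apply_ne_top a), h, ENNReal.toReal_one]

theorem entropy_comp_of_injective (q : ℕ) {Ω α β : Type*} [Fintype α] [Fintype β] (P : PMF Ω)
    (X : Ω → α) {f : α → β} (hf : Function.Injective f) :
    entropy q P (fun ω => f (X ω)) = entropy q P X := by
  have h : P.map (fun ω => f (X ω)) = (P.map X).map f := (PMF.map_comp X P f).symm
  unfold entropy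
  rw [h]
  symm
  refine Finset.sum_of_injOn f hf.injOn (by simp) ?_ ?_
  · intro b _ hb
    have : ((P.map X).map f) b = 0 := by
      rw [PMF.apply_eq_zero_iff, PMF.support_map]
      rintro ⟨a, -, rfl⟩
      exact hb ⟨a, by simp, rfl⟩
    simp [this]
  · intro a _
    rw [map_apply_of_injective _ hf]

theorem entropy_prodMk_of_mul (q : ℕ) {Ω α β : Type*} [Fintype α] [Fintype β] (P : PMF Ω)
    (X : Ω → α) (Y : Ω → β)
    (h : ∀ a b, (P.map fun ω => (X ω, Y ω)) (a, b) = (P.map X) a * (P.map Y) b) :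
    entropy q P (fun ω => (X ω, Y ω)) = entropy q P X + entropy q P Y := by
  unfold entropy
  rw [Fintype.sum_prod_type]
  simp only [h, ENNReal.toReal_mul, Real.negMulLog_mul, add_div, Finset.sum_add_distrib]
  congr 1
  · simp only [mul_div_assoc, ← Finset.sum_mul, sum_toReal_eq_one, one_mul]
  · simp only [mul_div_assoc, ← Finset.mul_sum]
    simp only [← Finset.sum_mul, sum_toReal_eq_one, one_mul]

theorem uniformOfFintype_map_equiv {α : Type*} [Fintype α] [Nonempty α] (e : α ≃ α) :
    (PMF.uniformOfFintype α).map e = PMF.uniformOfFintype α := by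
  ext a
  obtain ⟨b, rfl⟩ := e.surjective a
  rw [map_apply_of_injective _ e.injective]
  simp

namespace Scheme

variable {F : Type*} {N M L : ℕ} (σ : Scheme F N M L) {T : ℕ}

/-- A random variable of `T` rounds is *source-blind* if any two sources can be matched by a
permutation of the noise that preserves its value. Under every prior such a variable is
independent of the source. -/
def SourceBlind {β : Type*} (Y : σ.Outcome T → β) : Prop :=
  ∀ x x' : Source F M L T, ∃ e : σ.Noise T ≃ σ.Noise T, ∀ z, Y (x', e z) = Y (x, z)

variable {σ}

theorem SourceBlind.comp {β γ : Type*} {Y : σ.Outcome T → β} (hY : σ.SourceBlind Y) (g : β → γ) :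
    σ.SourceBlind fun ω => g (Y ω) := fun x x' => by
  obtain ⟨e, he⟩ := hY x x'
  exact ⟨e, fun z => congrArg g (he z)⟩

variable [Fintype F] [Nonempty F]

theorem SourceBlind.map_law_mul {α β : Type*} {Y : σ.Outcome T → β} (hY : σ.SourceBlind Y)
    (f : Source F M L T → α) (prior : PMF (Source F M L T)) (a : α) (b : β) :
    ((σ.law prior).map fun ω => (f ω.1, Y ω)) (a, b) =
      ((σ.law prior).map fun ω => f ω.1) a * ((σ.law prior).map Y) b := by
  obtain ⟨x₀, -⟩ := prior.support_nonempty
  set ν := (PMF.uniformOfFintype (σ.Noise T)).map fun z => Y (x₀, z) with hν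
  have hx : ∀ x, (PMF.uniformOfFintype (σ.Noise T)).map (fun z => Y (x, z)) = ν := by
    intro x
    obtain ⟨e, he⟩ := hY x₀ x
    rw [hν, ← uniformOfFintype_map_equiv e, PMF.map_comp, uniformOfFintype_map_equiv e]
    congr 1
    funext z
    exact he z
  have h1 : (σ.law prior).map (fun ω => (f ω.1, Y ω)) =
      prior.bind fun x => ν.map fun b => (f x, b) := by
    unfold law
    rw [PMF.map_bind]
    congr 1
    funext x
    rw [PMF.map_comp, ← hx x, PMF.map_comp]
    rfl
  have h2 : (σ.law prior).map Y = ν := by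
    have : Y = Prod.snd ∘ fun ω : σ.Outcome T => (f ω.1, Y ω) := rfl
    rw [this, ← PMF.map_comp, h1, PMF.map_bind]
    simp only [PMF.map_comp]
    exact (congrArg (PMF.bind prior) (funext fun _ => PMF.map_id ν)).trans (PMF.bind_const prior ν)
  have h3 : (σ.law prior).map (fun ω => f ω.1) = prior.map f := by
    have : (fun ω : σ.Outcome T => f ω.1) = Prod.fst ∘ fun ω : σ.Outcome T => (f ω.1, Y ω) := rfl
    rw [this, ← PMF.map_comp, h1, PMF.map_bind]
    simp only [PMF.map_comp, Function.comp_def]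
    rw [← PMF.bind_pure_comp]
    congr 1
    funext x
    exact PMF.map_const ν (f x)
  classical
  have h4 : ∀ x, (ν.map fun b => (f x, b)) (a, b) = (if a = f x then 1 else 0) * ν b := by
    intro x
    by_cases hax : a = f x
    · subst hax
      rw [if_pos rfl, one_mul]
      exact map_apply_of_injective ν (fun b b' h => (Prod.mk.inj h).2) b
    · rw [if_neg hax, zero_mul, PMF.apply_eq_zero_iff, PMF.support_map]
      rintro ⟨b', -, hb'⟩
      exact hax (Prod.mk.inj hb').1.symm
  rw [h1, h2, h3, PMF.bind_apply, PMF.map_apply]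
  simp only [h4, ← mul_assoc, ENNReal.tsum_mul_right]
  congr 2
  funext x
  split_ifs <;> simp

theorem SourceBlind.entropy_prodMk {α β : Type*} [Fintype α] [Fintype β] {Y : σ.Outcome T → β}
    (hY : σ.SourceBlind Y) (f : Source F M L T → α) (prior : PMF (Source F M L T)) (q : ℕ) :
    entropy q (σ.law prior) (fun ω => (f ω.1, Y ω)) =
      entropy q (σ.law prior) (fun ω => f ω.1) + entropy q (σ.law prior) Y :=
  entropy_prodMk_of_mul q _ _ _ (hY.map_law_mul f prior)

theorem SourceBlind.condMutualInfo_eq_zero {α β γ : Type*} [Fintype α] [Fintype β] [Fintype γ]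
    {Y : σ.Outcome T → β} {Z : σ.Outcome T → γ} (h : σ.SourceBlind fun ω => (Y ω, Z ω))
    (f : Source F M L T → α) (prior : PMF (Source F M L T)) (q : ℕ) :
    condMutualInfo q (σ.law prior) (fun ω => f ω.1) Y Z = 0 := by
  have hZ : σ.SourceBlind Z := h.comp Prod.snd
  unfold condMutualInfo condEntropy
  rw [hZ.entropy_prodMk, h.entropy_prodMk]
  ring

theorem SourceBlind.mutualInfo_eq_zero {α β : Type*} [Fintype α] [Fintype β]
    {Y : σ.Outcome T → β} (h : σ.SourceBlind Y)
    (f : Source F M L T → α) (prior : PMF (Source F M L T)) (q : ℕ) :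
    mutualInfo q (σ.law prior) (fun ω => f ω.1) Y = 0 := by
  unfold mutualInfo condEntropy
  rw [h.entropy_prodMk]
  ring

theorem condEntropy_eq_zero_of_function {Ω α β : Type*} [Fintype α] [Fintype β] (q : ℕ)
    (P : PMF Ω) {X : Ω → α} {Y : Ω → β} (d : β → α) (h : ∀ ω, X ω = d (Y ω)) :
    condEntropy q P X Y = 0 := by
  unfold condEntropy
  obtain rfl : X = fun ω => d (Y ω) := funext h
  rw [entropy_comp_of_injective q P Y (f := fun b => (d b, b)) (fun b b' hb => (Prod.mk.inj hb).2)]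
  ring

end Scheme

/-! ### A combinatorial criterion for valid schemes -/

namespace Scheme

variable {F : Type*} {N M L : ℕ}

/-- A scheme is *masked* if the uploads ignore the answers, a single database cannot tell the
initial submodels from its contents nor the index and the update from what it receives in a round
(any two possibilities are matched by a permutation of the noise), and a refresh adds to the
contents a term that does not depend on them. The shift `c` in `init_mask` makes the initial
contents of each database uniform. -/
structure IsMasked [Field F] (σ : Scheme F N M L) : Prop where
  upload_congr : ∀ θ z A A' Δ, σ.upload θ z A Δ = σ.upload θ z A' Δ
  init_mask : ∀ n W W' c, ∃ e : (Fin σ.storeNoiseLen → F) ≃ (Fin σ.storeNoiseLen → F),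
    ∀ z, σ.init W' (e z) n = σ.init W z n + c
  user_mask : ∀ n θ θ' Δ Δ', ∃ e : (Fin σ.userNoiseLen → F) ≃ (Fin σ.userNoiseLen → F),
    ∀ z A, σ.query θ' (e z) n = σ.query θ z n ∧
      σ.upload θ' (e z) A Δ' n = σ.upload θ z A Δ n
  refresh_add : ∀ n s c q u, σ.refresh n (s + c) q u = σ.refresh n s q u + c

/-- Correctness of reading and writing relative to a set `Inv` of joint contents that contains the
initial contents and is closed under the rounds of the scheme. -/
structure IsFaithful [Field F] (σ : Scheme F N M L)
    (Inv : ((n : Fin N) → Fin (σ.storeLen n) → F) → Prop) : Prop where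
  inv_init : ∀ W z, Inv (σ.init W z)
  recover_init : ∀ W z, σ.recover (σ.init W z) = W
  inv_step : ∀ s θ z A Δ, Inv s →
    Inv fun n => σ.refresh n (s n) (σ.query θ z n) (σ.upload θ z A Δ n)
  recover_step : ∀ s θ z A Δ, Inv s → ∀ m,
    σ.recover (fun n => σ.refresh n (s n) (σ.query θ z n) (σ.upload θ z A Δ n)) m =
      if m = θ then σ.recover s m + Δ else σ.recover s m
  read : ∃ d : ((n : Fin N) → Fin (σ.answerLen n) → F) → Fin L → F, ∀ s θ z, Inv s →
    d (fun n => σ.answer n (s n) (σ.query θ z n)) = σ.recover s θ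

variable {σ : Scheme F N M L} {T : ℕ}

theorem S_zero (σ : Scheme F N M L) (ω : σ.Outcome T) : σ.S ω 0 = σ.init ω.1.models ω.2.1 := rfl

theorem S_succ (σ : Scheme F N M L) (ω : σ.Outcome T) (t : Fin T) :
    σ.S ω t.succ = fun n => σ.refresh n (σ.S ω t.castSucc n) (σ.Q t n ω) (σ.U t n ω) := by
  unfold S
  rw [Fin.induction_succ]
  rfl

variable [Field F]

theorem IsFaithful.inv_S {Inv} (h : σ.IsFaithful Inv) (ω : σ.Outcome T) (t : Fin (T + 1)) :
    Inv (σ.S ω t) := by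
  induction t using Fin.induction with
  | zero => exact h.inv_init _ _
  | succ t ih =>
    rw [S_succ]
    exact h.inv_step _ _ _ _ _ ih

theorem IsFaithful.W_succ {Inv} (h : σ.IsFaithful Inv) (ω : σ.Outcome T) (t : Fin T) (m : Fin M) :
    σ.W t.succ ω m =
      if m = σ.theta t ω then σ.W t.castSucc ω m + σ.delta t ω else σ.W t.castSucc ω m := by
  unfold W
  rw [S_succ]
  exact h.recover_step _ _ _ _ _ (h.inv_S ω _) m

/-- The submodels at time `t` are a function of the source. -/
theorem IsFaithful.W_congr {Inv} (h : σ.IsFaithful Inv) (x : Source F M L T) (z z' : σ.Noise T)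
    (t : Fin (T + 1)) : σ.W t (x, z) = σ.W t (x, z') := by
  induction t using Fin.induction with
  | zero => exact (h.recover_init _ _).trans (h.recover_init _ _).symm
  | succ t ih =>
    funext m
    rw [h.W_succ, h.W_succ, ih]
    rfl

/-- Permutations of the noise of the storage and of the rounds, chosen round by round, match the
views of a database under two sources up to a constant shift of its contents. -/
theorem IsMasked.exists_noise_equiv (h : σ.IsMasked) (n : Fin N) (x x' : Source F M L T)
    (c : Fin (σ.storeLen n) → F) :
    ∃ e : σ.Noise T ≃ σ.Noise T, ∀ z,
      (∀ t, σ.Q t n (x', e z) = σ.Q t n (x, z)) ∧ (∀ t, σ.U t n (x', e z) = σ.U t n (x, z)) ∧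
      ∀ t, σ.S (x', e z) t n = σ.S (x, z) t n + c := by
  obtain ⟨e₀, he₀⟩ := h.init_mask n x.models x'.models c
  choose e₁ he₁ using fun t => h.user_mask n (x.index t) (x'.index t) (x.delta t) (x'.delta t)
  obtain ⟨e, he⟩ : ∃ e : σ.Noise T ≃ σ.Noise T, ∀ z, e z = (e₀ z.1, fun t => e₁ t (z.2 t)) :=
    ⟨e₀.prodCongr (Equiv.piCongrRight e₁), fun _ => rfl⟩
  refine ⟨e, fun z => ?_⟩
  have hQ : ∀ t, σ.Q t n (x', e z) = σ.Q t n (x, z) := fun t => by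
    rw [he]
    exact (he₁ t (z.2 t) (fun _ _ => 0)).1
  have hU : ∀ t, σ.U t n (x', e z) = σ.U t n (x, z) := fun t => by
    unfold U uploadsFrom
    rw [he, h.upload_congr _ _ _ (fun _ _ => 0), h.upload_congr (x.index t) _ _ (fun _ _ => 0)]
    exact (he₁ t (z.2 t) (fun _ _ => 0)).2
  refine ⟨hQ, hU, fun t => ?_⟩
  induction t using Fin.induction with
  | zero =>
    rw [S_zero, S_zero, he]
    exact he₀ z.1
  | succ t ih => simp only [S_succ, hQ, hU, ih, h.refresh_add]

/-- Everything that database `n` ever stores or receives. -/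
def view (σ : Scheme F N M L) (n : Fin N) (ω : σ.Outcome T) :
    (Fin (T + 1) → Fin (σ.storeLen n) → F) × (Fin T → Fin (σ.queryLen n) → F) ×
      (Fin T → Fin (σ.updateLen n) → F) :=
  (fun t => σ.S ω t n, fun t => σ.Q t n ω, fun t => σ.U t n ω)

theorem IsMasked.sourceBlind_view (h : σ.IsMasked) (n : Fin N) :
    σ.SourceBlind (T := T) (σ.view n) := fun x x' => by
  obtain ⟨e, he⟩ := h.exists_noise_equiv n x x' 0
  refine ⟨e, fun z => ?_⟩
  obtain ⟨hQ, hU, hS⟩ := he z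
  simp only [view, hQ, hU, hS, add_zero]

variable [Fintype F]

theorem IsMasked.isValid (h : σ.IsMasked) {Inv} (h' : σ.IsFaithful Inv) : σ.IsValid where
  index_privacy T prior t n :=
    SourceBlind.condMutualInfo_eq_zero (Y := fun ω => (σ.Q t n ω, σ.U t n ω))
      (Z := fun ω => (σ.pastQ t n ω, σ.pastS t n ω, σ.pastU t n ω))
      ((h.sourceBlind_view n).comp fun v =>
        ((v.2.1 t, v.2.2 t), (fun i : {i : Fin T // i < t} => v.2.1 i,
          fun i : {i : Fin (T + 1) // i ≤ t.castSucc} => v.1 i,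
          fun i : {i : Fin T // i < t} => v.2.2 i)))
      (fun x => x.index t) prior _
  update_privacy T prior t n :=
    SourceBlind.condMutualInfo_eq_zero (Y := σ.U t n)
      (Z := fun ω => ((σ.pastQ t n ω, σ.Q t n ω), σ.pastS t n ω, σ.pastU t n ω))
      ((h.sourceBlind_view n).comp fun v =>
        (v.2.2 t, ((fun i : {i : Fin T // i < t} => v.2.1 i, v.2.1 t),
          fun i : {i : Fin (T + 1) // i ≤ t.castSucc} => v.1 i,
          fun i : {i : Fin T // i < t} => v.2.2 i)))
      (fun x => x.delta t) prior _
  security T prior t n := by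
    have : σ.W t = fun ω : σ.Outcome T => (fun x => σ.W t (x, 0)) ω.1 :=
      funext fun ω => h'.W_congr ω.1 ω.2 0 t
    rw [this]
    exact SourceBlind.mutualInfo_eq_zero (Y := fun ω => σ.S ω t n)
      ((h.sourceBlind_view n).comp fun v => v.1 t) (fun x => σ.W t (x, 0)) prior _
  read_correct T prior t := by
    obtain ⟨d, hd⟩ := h'.read
    exact condEntropy_eq_zero_of_function _ _ (fun y => d y.2) fun ω =>
      (hd _ _ _ (h'.inv_S ω t.castSucc)).symm
  init_correct T ω := h'.recover_init _ _
  write_correct T ω t m := h'.W_succ ω t m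

theorem entropy_eq_of_shift_invariant {Ω : Type*} {l : ℕ} (P : PMF Ω) (Y : Ω → Fin l → F)
    (h : ∀ c, P.map (fun ω => Y ω + c) = P.map Y) : entropy (Fintype.card F) P Y = l := by
  have hconst : ∀ y, (P.map Y) y = (P.map Y) 0 := fun y => by
    have h1 : P.map (fun ω => Y ω + y) = (P.map Y).map (fun v => v + y) :=
      (PMF.map_comp Y P (fun v => v + y)).symm
    have h2 := map_apply_of_injective (P.map Y) (add_left_injective y) 0
    rw [← h1, h] at h2
    simpa using h2
  have hq : (1 : ℝ) < Fintype.card F := by exact_mod_cast Fintype.one_lt_card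
  have hlog : Real.log (Fintype.card F) ≠ 0 := (Real.log_pos hq).ne'
  have hcard : (Fintype.card (Fin l → F) : ℝ) = (Fintype.card F : ℝ) ^ l := by simp
  have hpow : ((Fintype.card F : ℝ) ^ l) ≠ 0 := by positivity
  have hval : ((P.map Y) 0).toReal = ((Fintype.card F : ℝ) ^ l)⁻¹ := by
    have h1 := sum_toReal_eq_one (P.map Y)
    simp only [hconst, Finset.sum_const, Finset.card_univ, nsmul_eq_mul] at h1
    rw [hcard] at h1
    exact eq_inv_of_mul_eq_one_right h1
  unfold entropy
  simp only [hconst, Finset.sum_const, Finset.card_univ, nsmul_eq_mul]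
  rw [hcard, hval, Real.negMulLog, Real.log_inv, Real.log_pow]
  field_simp

theorem IsMasked.isFull (h : σ.IsMasked) : σ.IsFull := fun T prior t n =>
  entropy_eq_of_shift_invariant _ _ fun c => by
    unfold law
    rw [PMF.map_bind, PMF.map_bind]
    congr 1
    funext x
    obtain ⟨e, he⟩ := h.exists_noise_equiv n x x c
    rw [PMF.map_comp, PMF.map_comp]
    conv_rhs => rw [← uniformOfFintype_map_equiv e, PMF.map_comp]
    congr 1
    funext z
    exact ((he z).2.2 t).symm

end Scheme
end PRUW

noncomputable section

namespace PRUW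

/-! ### The coded scheme: polynomials -/

/-- A code layout. Every part `p` carries `ℓ p` chunks of `a` symbols of each submodel and uses
the `a + 2 * ℓ p` databases in `B p`. Database `n` owns the point `α n`, and symbol `j` of chunk
`i` of part `p` owns the point `f p i j`. -/
structure Layout (F : Type*) [Field F] (N a : ℕ) (P : Type*) where
  /-- the databases used by a part -/
  B : P → Finset (Fin N)
  /-- the number of chunks of a part -/
  ℓ : P → ℕ
  card_B : ∀ p, (B p).card = a + 2 * ℓ p
  /-- the evaluation point of a database -/
  α : Fin N → F
  α_injective : Function.Injective α
  /-- the evaluation point of a symbol -/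
  f : ∀ p, Fin (ℓ p) → Fin a → F
  f_injective : ∀ p, Function.Injective fun x : Fin (ℓ p) × Fin a => f p x.1 x.2
  α_ne_f : ∀ n p i j, α n ≠ f p i j

namespace Layout

open Polynomial

variable {F : Type*} [Field F] {N a : ℕ} {P : Type*} (Λ : Layout F N a P)

/-- The chunks of all parts. -/
abbrev Chunk : Type _ := Σ p, Fin (Λ.ℓ p)

/-- The symbols of all parts. -/
abbrev Sym : Type _ := Λ.Chunk × Fin a

/-- The point of a symbol. -/
def pt (c : Λ.Chunk) (j : Fin a) : F := Λ.f c.1 c.2 j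

/-- The Lagrange basis polynomial of symbol `j` among the symbols of its chunk. -/
def H (c : Λ.Chunk) (j : Fin a) : F[X] := Lagrange.basis Finset.univ (Λ.pt c) j

/-- The Lagrange basis polynomial of chunk `i` among the `j`-th symbols of the chunks of a part. -/
def G (c : Λ.Chunk) (j : Fin a) : F[X] :=
  Lagrange.basis Finset.univ (fun i => Λ.f c.1 i j) c.2

/-- The monic polynomial that vanishes at the points of a chunk. -/
def Z (c : Λ.Chunk) : F[X] := Lagrange.nodal Finset.univ (Λ.pt c)

theorem pt_injective (c : Λ.Chunk) : Function.Injective (Λ.pt c) := fun j j' h =>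
  (Prod.mk.inj (Λ.f_injective c.1 (a₁ := (c.2, j)) (a₂ := (c.2, j')) h)).2

theorem eval_H (c : Λ.Chunk) (j j' : Fin a) :
    (Λ.H c j).eval (Λ.pt c j') = if j' = j then 1 else 0 := by
  unfold H
  split_ifs with h
  · subst h
    exact Lagrange.eval_basis_self (Λ.pt_injective c).injOn (Finset.mem_univ _)
  · exact Lagrange.eval_basis_of_ne (Ne.symm h) (Finset.mem_univ _)

theorem eval_G (p : P) (i i' : Fin (Λ.ℓ p)) (j : Fin a) :
    (Λ.G ⟨p, i⟩ j).eval (Λ.pt ⟨p, i'⟩ j) = if i' = i then 1 else 0 := by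
  have hinj : Function.Injective fun i => Λ.f p i j := fun i i' h =>
    (Prod.mk.inj (Λ.f_injective p (a₁ := (i, j)) (a₂ := (i', j)) h)).1
  unfold G pt
  split_ifs with h
  · subst h
    exact Lagrange.eval_basis_self hinj.injOn (Finset.mem_univ _)
  · exact Lagrange.eval_basis_of_ne (v := fun i => Λ.f p i j) (Ne.symm h) (Finset.mem_univ _)

theorem eval_Z_pt (c : Λ.Chunk) (j : Fin a) : (Λ.Z c).eval (Λ.pt c j) = 0 :=
  Lagrange.eval_nodal_at_node (Finset.mem_univ j)

theorem eval_Z_α (c : Λ.Chunk) (n : Fin N) : (Λ.Z c).eval (Λ.α n) ≠ 0 :=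
  Lagrange.eval_nodal_not_at_node fun j _ => Λ.α_ne_f n c.1 c.2 j

theorem natDegree_H (c : Λ.Chunk) (j : Fin a) : (Λ.H c j).natDegree = a - 1 := by
  unfold H
  rw [Lagrange.natDegree_basis (Λ.pt_injective c).injOn (Finset.mem_univ _)]
  simp

theorem natDegree_G (c : Λ.Chunk) (j : Fin a) : (Λ.G c j).natDegree = Λ.ℓ c.1 - 1 := by
  have hinj : Function.Injective fun i => Λ.f c.1 i j := fun i i' h =>
    (Prod.mk.inj (Λ.f_injective c.1 (a₁ := (i, j)) (a₂ := (i', j)) h)).1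
  unfold G
  rw [Lagrange.natDegree_basis hinj.injOn (Finset.mem_univ _)]
  simp

theorem natDegree_Z (c : Λ.Chunk) : (Λ.Z c).natDegree = a := by
  unfold Z
  rw [Lagrange.natDegree_nodal]
  simp

theorem ℓ_pos (c : Λ.Chunk) : 0 < Λ.ℓ c.1 := c.2.pos

/-! ### The coded scheme: encoding, queries, answers and updates -/

variable {M : ℕ}

/-- Initial contents of database `n`: the value at `α n` of the polynomial that interpolates a
chunk, plus a noise multiple of the polynomial vanishing on the chunk. -/
def encode (W : Fin M → Λ.Sym → F) (v : Fin M × Λ.Chunk → F) (n : Fin N) (x : Fin M × Λ.Chunk) :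
    F :=
  ∑ j, W x.1 (x.2, j) * (Λ.H x.2 j).eval (Λ.α n) + v x * (Λ.Z x.2).eval (Λ.α n)

/-- The share of database `n` of the indicator of `θ`, one for each symbol of each submodel. -/
def share (θ : Fin M) (r : Fin M × Λ.Sym → F) (n : Fin N) (x : Fin M × Λ.Sym) : F :=
  (if x.1 = θ then 1 else 0) + (Λ.α n - Λ.pt x.2.1 x.2.2) * r x

/-- The mask, sent along with the queries, that cancels the effect of the one-time pad on the
contents of database `n`; it is hidden by a noise multiple of the vanishing polynomial. -/
def mask (θ : Fin M) (r : Fin M × Λ.Sym → F) (k : Fin N × P × Fin a → F)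
    (w : Fin M × Λ.Chunk → F) (n : Fin N) (x : Fin M × Λ.Chunk) : F :=
  ∑ j, k (n, x.2.1, j) * Λ.share θ r n (x.1, x.2, j) * (Λ.H x.2 j).eval (Λ.α n) +
    w x * (Λ.Z x.2).eval (Λ.α n)

/-- The answer of database `n`, one symbol for each part and each `j`. -/
def reply (n : Fin N) (s : Fin M × Λ.Chunk → F) (q : Fin M × Λ.Sym → F) (y : P × Fin a) : F :=
  ∑ i : Fin (Λ.ℓ y.1), ∑ m, s (m, ⟨y.1, i⟩) * q (m, ⟨y.1, i⟩, y.2) *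
    (Λ.G ⟨y.1, i⟩ y.2).eval (Λ.α n)

/-- The combined update of all chunks of a part, protected by a one-time pad. -/
def combine (k : Fin N × P × Fin a → F) (Δ : Λ.Sym → F) (n : Fin N) (y : P × Fin a) : F :=
  ∑ i : Fin (Λ.ℓ y.1), Δ (⟨y.1, i⟩, y.2) * (Λ.G ⟨y.1, i⟩ y.2).eval (Λ.α n) + k (n, y)

/-- What database `n` adds to its contents. -/
def increment (n : Fin N) (q : Fin M × Λ.Sym → F) (h : Fin M × Λ.Chunk → F) (u : P × Fin a → F)
    (x : Fin M × Λ.Chunk) : F :=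
  ∑ j, u (x.2.1, j) * q (x.1, x.2, j) * (Λ.H x.2 j).eval (Λ.α n) - h x

/-- The submodels represented by the contents of all databases, by interpolation. -/
def decode (s : Fin N → Fin M × Λ.Chunk → F) (m : Fin M) (y : Λ.Sym) : F :=
  (Lagrange.interpolate (Λ.B y.1.1) Λ.α fun n => s n (m, y.1)).eval (Λ.pt y.1 y.2)

/-- The submodel read off from the answers of all databases, by interpolation. -/
def decodeReply (A : Fin N → P × Fin a → F) (y : Λ.Sym) : F :=
  (Lagrange.interpolate (Λ.B y.1.1) Λ.α fun n => A n (y.1.1, y.2)).eval (Λ.pt y.1 y.2)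

/-- The contents are values of polynomials of degree less than `a + ℓ p`, while the number of
databases is `a + 2 * ℓ p`. -/
def IsCoded (s : Fin N → Fin M × Λ.Chunk → F) : Prop :=
  ∀ m c, ∃ R : F[X], R.natDegree < a + Λ.ℓ c.1 ∧ ∀ n ∈ Λ.B c.1, s n (m, c) = R.eval (Λ.α n)

variable {Λ}

theorem eval_interpolate_eq (p : P) {R : F[X]} (hR : R.natDegree < a + 2 * Λ.ℓ p)
    {s : Fin N → F} (hs : ∀ n ∈ Λ.B p, s n = R.eval (Λ.α n)) (y : F) :
    (Lagrange.interpolate (Λ.B p) Λ.α s).eval y = R.eval y := by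
  congr 1
  symm
  refine Lagrange.eq_interpolate_of_eval_eq _ Λ.α_injective.injOn ?_ fun n hn => (hs n hn).symm
  rw [Λ.card_B]
  exact degree_le_natDegree.trans_lt (by exact_mod_cast hR)

theorem decode_eq {s : Fin N → Fin M × Λ.Chunk → F} {m : Fin M} {c : Λ.Chunk} {R : F[X]}
    (hR : R.natDegree < a + Λ.ℓ c.1) (hs : ∀ n ∈ Λ.B c.1, s n (m, c) = R.eval (Λ.α n))
    (j : Fin a) : Λ.decode s m (c, j) = R.eval (Λ.pt c j) :=
  eval_interpolate_eq c.1 (by omega) hs _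

theorem decode_congr {s s' : Fin N → Fin M × Λ.Chunk → F}
    (h : ∀ n x, n ∈ Λ.B x.2.1 → s n x = s' n x) : Λ.decode s = Λ.decode s' := by
  funext m y
  exact congrArg (eval _) (Lagrange.interpolate_eq_of_values_eq_on _ _ fun n hn => h n _ hn)

theorem IsCoded.congr {s s' : Fin N → Fin M × Λ.Chunk → F} (hs : Λ.IsCoded s)
    (h : ∀ n x, n ∈ Λ.B x.2.1 → s' n x = s n x) : Λ.IsCoded s' := fun m c => by
  obtain ⟨R, hR, hR'⟩ := hs m c
  exact ⟨R, hR, fun n hn => (h n (m, c) hn).trans (hR' n hn)⟩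

theorem exists_poly_encode (ha : 0 < a) (W : Fin M → Λ.Sym → F) (v : Fin M × Λ.Chunk → F)
    (m : Fin M) (c : Λ.Chunk) : ∃ R : F[X], R.natDegree < a + Λ.ℓ c.1 ∧
      (∀ n, Λ.encode W v n (m, c) = R.eval (Λ.α n)) ∧ ∀ j, R.eval (Λ.pt c j) = W m (c, j) := by
  refine ⟨∑ j, C (W m (c, j)) * Λ.H c j + C (v (m, c)) * Λ.Z c, ?_, fun n => ?_, fun j => ?_⟩
  · have := Λ.ℓ_pos c
    refine Nat.lt_of_le_of_lt (natDegree_add_le_of_degree_le (n := a) ?_ ?_) (by omega)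
    · refine natDegree_sum_le_of_forall_le _ _ fun j _ => ?_
      refine (natDegree_C_mul_le _ _).trans ?_
      rw [natDegree_H]
      omega
    · exact (natDegree_C_mul_le _ _).trans (Λ.natDegree_Z c).le
  · simp [encode, eval_finsetSum]
  · simp [eval_finsetSum, eval_H, eval_Z_pt]

theorem isCoded_encode (ha : 0 < a) (W : Fin M → Λ.Sym → F) (v : Fin M × Λ.Chunk → F) :
    Λ.IsCoded (Λ.encode W v) := fun m c => by
  obtain ⟨R, hR, h, -⟩ := exists_poly_encode ha W v m c
  exact ⟨R, hR, fun n _ => h n⟩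

theorem decode_encode (ha : 0 < a) (W : Fin M → Λ.Sym → F) (v : Fin M × Λ.Chunk → F) :
    Λ.decode (Λ.encode W v) = W := by
  funext m ⟨c, j⟩
  obtain ⟨R, hR, h, h'⟩ := exists_poly_encode ha W v m c
  rw [decode_eq hR (fun n _ => h n), h']


theorem natDegree_share_le (x y z : F) : (C x + (X - C y) * C z).natDegree ≤ 1 := by
  compute_degree

/-- The increments of a round are the values of a polynomial of degree less than `a + ℓ p` which
represents the update in the submodel `θ` and zero in all other submodels: the one-time pad has
been cancelled by the mask. -/
theorem exists_poly_increment (ha : 0 < a) (θ : Fin M) (r : Fin M × Λ.Sym → F)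
    (k : Fin N × P × Fin a → F) (w : Fin M × Λ.Chunk → F) (Δ : Λ.Sym → F) (m : Fin M)
    (c : Λ.Chunk) : ∃ R : F[X], R.natDegree < a + Λ.ℓ c.1 ∧
      (∀ n, Λ.increment n (Λ.share θ r n) (Λ.mask θ r k w n) (Λ.combine k Δ n) (m, c) =
        R.eval (Λ.α n)) ∧
      ∀ j, R.eval (Λ.pt c j) = if m = θ then Δ (c, j) else 0 := by
  have hℓ := Λ.ℓ_pos c
  refine ⟨∑ j, (∑ i, C (Δ (⟨c.1, i⟩, j)) * Λ.G ⟨c.1, i⟩ j) *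
      (C (if m = θ then 1 else 0) + (X - C (Λ.pt c j)) * C (r (m, c, j))) * Λ.H c j -
      C (w (m, c)) * Λ.Z c, ?_, fun n => ?_, fun j => ?_⟩
  · refine Nat.lt_of_le_of_lt (natDegree_sub_le_of_le (m := a + Λ.ℓ c.1 - 1) ?_
      ((natDegree_C_mul_le _ _).trans (Λ.natDegree_Z c).le)) (by omega)
    refine natDegree_sum_le_of_forall_le _ _ fun j _ => ?_
    refine (natDegree_mul_le_of_le (natDegree_mul_le_of_le (m := Λ.ℓ c.1 - 1) ?_
      (natDegree_share_le _ _ _)) (Λ.natDegree_H c j).le).trans (by omega)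
    refine natDegree_sum_le_of_forall_le _ _ fun i _ => ?_
    exact (natDegree_C_mul_le _ _).trans (Λ.natDegree_G ⟨c.1, i⟩ j).le
  · simp only [increment, mask, combine, share, eval_sub, eval_add, eval_mul, eval_C, eval_X,
      eval_finsetSum]
    rw [← sub_sub, ← Finset.sum_sub_distrib]
    congr 1
    refine Finset.sum_congr rfl fun j _ => ?_
    ring
  · obtain ⟨p, i⟩ := c
    simp [eval_finsetSum, eval_H, eval_G, eval_Z_pt, apply_ite (eval (Λ.pt ⟨p, i⟩ j))]

theorem isCoded_increment (ha : 0 < a) {s s' : Fin N → Fin M × Λ.Chunk → F} (hs : Λ.IsCoded s)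
    (θ : Fin M) (r : Fin M × Λ.Sym → F) (k : Fin N × P × Fin a → F) (w : Fin M × Λ.Chunk → F)
    (Δ : Λ.Sym → F)
    (hs' : ∀ n x, n ∈ Λ.B x.2.1 → s' n x = s n x +
      Λ.increment n (Λ.share θ r n) (Λ.mask θ r k w n) (Λ.combine k Δ n) x) :
    Λ.IsCoded s' ∧ ∀ m y, Λ.decode s' m y = Λ.decode s m y + if m = θ then Δ y else 0 := by
  have key : ∀ m c, ∃ R R' : F[X], R.natDegree < a + Λ.ℓ c.1 ∧ R'.natDegree < a + Λ.ℓ c.1 ∧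
      (∀ n ∈ Λ.B c.1, s n (m, c) = R.eval (Λ.α n)) ∧
      (∀ n ∈ Λ.B c.1, s' n (m, c) = R'.eval (Λ.α n)) ∧
      ∀ j, R'.eval (Λ.pt c j) = R.eval (Λ.pt c j) + if m = θ then Δ (c, j) else 0 := by
    intro m c
    obtain ⟨R, hR, h⟩ := hs m c
    obtain ⟨I, hI, h1, h2⟩ := exists_poly_increment ha θ r k w Δ m c
    refine ⟨R, R + I, hR, ?_, h, fun n hn => ?_, fun j => ?_⟩
    · exact (natDegree_add_le _ _).trans_lt (max_lt hR hI)
    · rw [hs' n (m, c) hn, h n hn, h1, eval_add]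
    · rw [eval_add, h2]
  refine ⟨fun m c => ?_, fun m ⟨c, j⟩ => ?_⟩
  · obtain ⟨R, R', -, hR', -, h', -⟩ := key m c
    exact ⟨R', hR', h'⟩
  · obtain ⟨R, R', hR, hR', h, h', hj⟩ := key m c
    rw [decode_eq hR h, decode_eq hR' h', hj]

/-- The answers are the values of a polynomial of degree less than the number `a + 2 * ℓ p` of
databases, whose value at the point of a symbol is that symbol of the submodel `θ`. -/
theorem decodeReply_reply {s : Fin N → Fin M × Λ.Chunk → F} (hs : Λ.IsCoded s)
    {A : Fin N → P × Fin a → F} (θ : Fin M) (r : Fin M × Λ.Sym → F)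
    (hA : ∀ n y, n ∈ Λ.B y.1 → A n y = Λ.reply n (s n) (Λ.share θ r n) y) :
    Λ.decodeReply A = Λ.decode s θ := by
  choose R hR h using hs
  funext ⟨⟨p, i₀⟩, j⟩
  have hℓ : 0 < Λ.ℓ p := i₀.pos
  rw [decode_eq (hR θ ⟨p, i₀⟩) (h θ ⟨p, i₀⟩)]
  unfold decodeReply
  rw [eval_interpolate_eq (R := ∑ i, ∑ m, R m ⟨p, i⟩ * (C (if m = θ then 1 else 0) +
      (X - C (Λ.pt ⟨p, i⟩ j)) * C (r (m, ⟨p, i⟩, j))) * Λ.G ⟨p, i⟩ j)]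
  · simp [eval_finsetSum, eval_G, apply_ite (eval (Λ.pt ⟨p, i₀⟩ j))]
  · refine Nat.lt_of_le_of_lt (m := a + Λ.ℓ p - 1 + 1 + (Λ.ℓ p - 1)) ?_ (by dsimp only; omega)
    refine natDegree_sum_le_of_forall_le _ _ fun i _ => ?_
    refine natDegree_sum_le_of_forall_le _ _ fun m _ => ?_
    refine natDegree_mul_le_of_le (natDegree_mul_le_of_le ?_ (natDegree_share_le _ _ _))
      (Λ.natDegree_G ⟨p, i⟩ j).le
    exact Nat.le_sub_one_of_lt (hR m ⟨p, i⟩)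
  · intro n hn
    rw [hA n _ hn]
    simp only [reply, share, eval_add, eval_mul, eval_sub, eval_C, eval_X, eval_finsetSum]
    refine Finset.sum_congr rfl fun i _ => Finset.sum_congr rfl fun m _ => ?_
    rw [h m ⟨p, i⟩ n hn]

end Layout
end PRUW

end

noncomputable section

namespace PRUW

/-! ### The coded scheme: placement into symbol arrays -/

section Slots

variable {F X : Type*} [Field F] {k : ℕ} {p : X → Prop}

open Classical in
/-- Read the symbol with label `x` from an array in which the labels satisfying `p` have places;
the value is `0` for the other labels. -/
def slotRead (ι : {x // p x} ↪ Fin k) (c : Fin k → F) (x : X) : F :=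
  if h : p x then c (ι ⟨x, h⟩) else 0

/-- The array that holds the symbols `v x` with `p x` in their places, and `0` elsewhere. -/
def slotWrite (ι : {x // p x} ↪ Fin k) (v : X → F) : Fin k → F :=
  Function.extend ι (fun x => v x.1) 0

theorem slotRead_of_pos (ι : {x // p x} ↪ Fin k) (c : Fin k → F) {x : X} (h : p x) :
    slotRead ι c x = c (ι ⟨x, h⟩) := dif_pos h

theorem slotWrite_apply (ι : {x // p x} ↪ Fin k) (v : X → F) (x : {x // p x}) :
    slotWrite ι v (ι x) = v x.1 := ι.injective.extend_apply _ _ _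

theorem slotWrite_of_notMem (ι : {x // p x} ↪ Fin k) (v : X → F) {i : Fin k}
    (h : i ∉ Set.range ι) : slotWrite ι v i = 0 :=
  Function.extend_apply' _ _ _ h

theorem slotRead_slotWrite (ι : {x // p x} ↪ Fin k) (v : X → F) {x : X} (h : p x) :
    slotRead ι (slotWrite ι v) x = v x := by
  rw [slotRead_of_pos ι _ h, slotWrite_apply]

end Slots

/-- A permutation of labelled noise gives a permutation of the array of noise symbols. -/
theorem exists_equiv_comp {F X : Type*} {k : ℕ} (e : X ≃ Fin k) (g : (X → F) ≃ (X → F)) :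
    ∃ g' : (Fin k → F) ≃ (Fin k → F), ∀ z, g' z ∘ e = g (z ∘ e) := by
  refine ⟨((e.arrowCongr (Equiv.refl F)).symm.trans g).trans (e.arrowCongr (Equiv.refl F)),
    fun z => ?_⟩
  funext x
  simp [Equiv.arrowCongr, Function.comp_def]

/-- A place in the arrays of a scheme for every symbol that a layout stores or sends. The arrays
may be longer than needed. -/
structure Placement {F : Type*} [Field F] {N a : ℕ} {P : Type*} (Λ : Layout F N a P)
    (M L : ℕ) where
  /-- the label of a symbol of a submodel; the other labels carry zeros -/
  sym : Fin L ↪ Λ.Sym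
  /-- length of the contents of a database -/
  storeLen : Fin N → ℕ
  /-- length of an answer -/
  answerLen : Fin N → ℕ
  /-- length of an upload -/
  updateLen : Fin N → ℕ
  /-- the places of the stored symbols -/
  store : ∀ n, {x : Fin M × Λ.Chunk // n ∈ Λ.B x.2.1} ↪ Fin (storeLen n)
  /-- the places of the answer symbols -/
  ans : ∀ n, {y : P × Fin a // n ∈ Λ.B y.1} ↪ Fin (answerLen n)
  /-- the places of the upload symbols -/
  upd : ∀ n, {y : P × Fin a // n ∈ Λ.B y.1} ↪ Fin (updateLen n)

namespace Placement

variable {F : Type*} [Field F] {N a : ℕ} {P : Type*} {Λ : Layout F N a P} {M L : ℕ}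
  (π : Placement Λ M L)

/-- Labels of the storage noise: one symbol for every chunk, and the filling of unused places. -/
abbrev StoreNoise : Type _ := (Fin M × Λ.Chunk) ⊕ (Σ n, Fin (π.storeLen n))

/-- Labels of the query symbols: shares and masks. -/
abbrev QueryLabel (_ : Placement Λ M L) : Type _ := (Fin M × Λ.Sym) ⊕ (Fin M × Λ.Chunk)

/-- Labels of the noise of a user: noise of the shares, one-time pads, noise of the masks. -/
abbrev UserNoise (_ : Placement Λ M L) : Type _ :=
  (Fin M × Λ.Sym) ⊕ (Fin N × P × Fin a) ⊕ (Fin M × Λ.Chunk)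

/-- The values of all labels, with zeros at the labels that no symbol uses. -/
def extend (v : Fin L → F) : Λ.Sym → F := Function.extend π.sym v 0

theorem extend_sym (v : Fin L → F) (l : Fin L) : π.extend v (π.sym l) = v l :=
  π.sym.injective.extend_apply _ _ _

theorem increment_slotRead (n : Fin N) (q : Fin M × Λ.Sym → F) (h : Fin M × Λ.Chunk → F)
    (u : P × Fin a → F) {x : Fin M × Λ.Chunk} (hx : n ∈ Λ.B x.2.1) :
    Λ.increment n q h (slotRead (π.upd n) (slotWrite (π.upd n) u)) x = Λ.increment n q h u x := by
  unfold Layout.increment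
  congr 1
  refine Finset.sum_congr rfl fun j _ => ?_
  rw [slotRead_slotWrite (p := fun y : P × Fin a => n ∈ Λ.B y.1) (π.upd n) u hx]

variable [Fintype P]

/-- numbering of the storage noise -/
def eS : π.StoreNoise ≃ Fin (Fintype.card π.StoreNoise) := Fintype.equivFin _

/-- numbering of the query symbols -/
def eQ : π.QueryLabel ≃ Fin (Fintype.card π.QueryLabel) := Fintype.equivFin _

/-- numbering of the user noise -/
def eU : π.UserNoise ≃ Fin (Fintype.card π.UserNoise) := Fintype.equivFin _

open Classical in
/-- Initial contents of database `n` from labelled noise. -/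
def initFrom (W : Models F M L) (z : π.StoreNoise → F) (n : Fin N) : Fin (π.storeLen n) → F :=
  slotWrite (π.store n) (Λ.encode (fun m => π.extend (W m)) (z ∘ Sum.inl) n) +
    fun i => if i ∈ Set.range (π.store n) then 0 else z (Sum.inr ⟨n, i⟩)

/-- Query to database `n` from labelled noise. -/
def queryFrom (θ : Fin M) (z : π.UserNoise → F) (n : Fin N) : π.QueryLabel → F :=
  Sum.elim (Λ.share θ (z ∘ Sum.inl) n)
    (Λ.mask θ (z ∘ Sum.inl) (z ∘ Sum.inr ∘ Sum.inl) (z ∘ Sum.inr ∘ Sum.inr) n)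

/-- Upload to database `n` from labelled noise. -/
def uploadFrom (z : π.UserNoise → F) (Δ : Fin L → F) (n : Fin N) : Fin (π.updateLen n) → F :=
  slotWrite (π.upd n) (Λ.combine (z ∘ Sum.inr ∘ Sum.inl) (π.extend Δ) n)

/-- The scheme of a layout with a placement. -/
def scheme : Scheme F N M L where
  storeLen := π.storeLen
  storeNoiseLen := Fintype.card π.StoreNoise
  init W z n := π.initFrom W (z ∘ π.eS) n
  recover s m l := Λ.decode (fun n => slotRead (π.store n) (s n)) m (π.sym l)
  userNoiseLen := Fintype.card π.UserNoise
  queryLen _ := Fintype.card π.QueryLabel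
  answerLen := π.answerLen
  updateLen := π.updateLen
  query θ z n := π.queryFrom θ (z ∘ π.eU) n ∘ π.eQ.symm
  answer n s q := slotWrite (π.ans n) (Λ.reply n (slotRead (π.store n) s) (q ∘ π.eQ ∘ Sum.inl))
  upload _ z _ Δ n := π.uploadFrom (z ∘ π.eU) Δ n
  refresh n s q u := s + slotWrite (π.store n) (Λ.increment n (q ∘ π.eQ ∘ Sum.inl)
    (q ∘ π.eQ ∘ Sum.inr) (slotRead (π.upd n) u))

/-- A shift of the noise of the chunks and of the filling moves the initial contents of one
database by any prescribed amount, whatever the submodels are. -/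
theorem exists_initFrom_eq (n : Fin N) (W W' : Models F M L) (c : Fin (π.storeLen n) → F) :
    ∃ g : (π.StoreNoise → F) ≃ (π.StoreNoise → F), ∀ z,
      π.initFrom W' (g z) n = π.initFrom W z n + c := by
  classical
  let d : π.StoreNoise → F := Sum.elim
    (fun x => (slotRead (π.store n) c x +
      (Λ.encode (fun m => π.extend (W m)) 0 n x - Λ.encode (fun m => π.extend (W' m)) 0 n x)) /
        (Λ.Z x.2).eval (Λ.α n))
    (fun x => if h : x.1 = n then c (h ▸ x.2) else 0)
  refine ⟨Equiv.addRight d, fun z => ?_⟩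
  funext i
  by_cases hi : i ∈ Set.range (π.store n)
  · obtain ⟨⟨x, hx⟩, rfl⟩ := hi
    simp only [initFrom, Pi.add_apply, slotWrite_apply, Set.mem_range_self, if_true, add_zero]
    have hZ := Λ.eval_Z_α x.2 n
    simp only [Layout.encode, Function.comp_apply, Equiv.coe_addRight, Pi.add_apply, d,
      Sum.elim_inl, Pi.zero_apply, zero_mul, add_zero,
      slotRead_of_pos (p := fun x : Fin M × Λ.Chunk => n ∈ Λ.B x.2.1) (π.store n) c hx]
    field_simp
    ring
  · simp only [initFrom, Pi.add_apply, slotWrite_of_notMem _ _ hi, if_neg hi]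
    simp [d]

/-- The view of database `n` in one round does not depend on the index and the update: shift the
noise of the shares to keep the shares, then the pads to keep the uploads, and finally the noise
of the masks to keep the masks. -/
theorem exists_queryFrom_eq [Finite F] (n : Fin N) (θ θ' : Fin M) (Δ Δ' : Fin L → F) :
    ∃ g : (π.UserNoise → F) ≃ (π.UserNoise → F), ∀ z,
      π.queryFrom θ' (g z) n = π.queryFrom θ z n ∧
        π.uploadFrom (g z) Δ' n = π.uploadFrom z Δ n := by
  let d₁ : Fin M × Λ.Sym → F := fun x =>
    ((if x.1 = θ then 1 else 0) - (if x.1 = θ' then 1 else 0)) / (Λ.α n - Λ.pt x.2.1 x.2.2)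
  let d₂ : Fin N × P × Fin a → F := fun y =>
    Λ.combine 0 (π.extend Δ) n y.2 - Λ.combine 0 (π.extend Δ') n y.2
  let d₃ : (Fin M × Λ.Sym → F) → Fin M × Λ.Chunk → F := fun r x =>
    -(∑ j, d₂ (n, x.2.1, j) * Λ.share θ r n (x.1, x.2, j) * (Λ.H x.2 j).eval (Λ.α n)) /
      (Λ.Z x.2).eval (Λ.α n)
  let g : (π.UserNoise → F) → (π.UserNoise → F) := fun z =>
    z + Sum.elim d₁ (Sum.elim d₂ (d₃ (z ∘ Sum.inl)))
  have hg : Function.Injective g := by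
    intro z z' h
    have h1 : z ∘ Sum.inl = z' ∘ Sum.inl := by
      funext x
      have := congrFun h (Sum.inl x)
      simpa [g] using this
    simpa [g, h1] using h
  refine ⟨Equiv.ofBijective g (Finite.injective_iff_bijective.mp hg), fun z => ?_⟩
  have hshare : Λ.share θ' (g z ∘ Sum.inl) n = Λ.share θ (z ∘ Sum.inl) n := by
    funext x
    have : Λ.α n - Λ.pt x.2.1 x.2.2 ≠ 0 := sub_ne_zero.mpr (Λ.α_ne_f _ _ _ _)
    simp only [Layout.share, g, Function.comp_apply, Pi.add_apply, Sum.elim_inl, d₁]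
    field_simp
    ring
  refine ⟨?_, ?_⟩
  · simp only [Equiv.ofBijective_apply, queryFrom, hshare]
    congr 1
    funext x
    have hZ := Λ.eval_Z_α x.2 n
    simp only [Layout.mask, hshare]
    simp only [g, Function.comp_apply, Pi.add_apply, Sum.elim_inl, Sum.elim_inr, d₃, add_mul,
      Finset.sum_add_distrib, div_mul_cancel₀ _ hZ, Function.comp_def]
    ring
  · simp only [Equiv.ofBijective_apply, uploadFrom]
    congr 1
    funext y
    simp only [Layout.combine, g, d₂, Function.comp_apply, Pi.add_apply, Sum.elim_inl,
      Sum.elim_inr, Pi.zero_apply]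
    ring

theorem isMasked [Finite F] : π.scheme.IsMasked where
  upload_congr _ _ _ _ _ := rfl
  init_mask n W W' c := by
    obtain ⟨g, hg⟩ := π.exists_initFrom_eq n W W' c
    obtain ⟨e, he⟩ := exists_equiv_comp π.eS g
    exact ⟨e, fun z => (congrArg (fun z' => π.initFrom W' z' n) (he z)).trans (hg _)⟩
  user_mask n θ θ' Δ Δ' := by
    obtain ⟨g, hg⟩ := π.exists_queryFrom_eq n θ θ' Δ Δ'
    obtain ⟨e, he⟩ := exists_equiv_comp π.eU g
    exact ⟨e, fun z A =>
      ⟨congrArg (· ∘ π.eQ.symm)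
        ((congrArg (fun z' => π.queryFrom θ' z' n) (he z)).trans (hg _).1),
      (congrArg (fun z' => π.uploadFrom z' Δ' n) (he z)).trans (hg _).2⟩⟩
  refresh_add n s c q u := add_right_comm _ _ _

/-- The stored symbols, by label. -/
def contents (s : (n : Fin N) → Fin (π.storeLen n) → F) (n : Fin N) : Fin M × Λ.Chunk → F :=
  slotRead (π.store n) (s n)

variable {π}

theorem contents_init (ha : 0 < a) (W : Models F M L) (z : π.StoreNoise → F) :
    Λ.IsCoded (π.contents (π.initFrom W z)) ∧
      Λ.decode (π.contents (π.initFrom W z)) = fun m => π.extend (W m) := by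
  classical
  have hc : ∀ n x, n ∈ Λ.B x.2.1 → π.contents (π.initFrom W z) n x =
      Λ.encode (fun m => π.extend (W m)) (z ∘ Sum.inl) n x := by
    intro n x hx
    unfold contents
    rw [slotRead_of_pos (p := fun x : Fin M × Λ.Chunk => n ∈ Λ.B x.2.1) (π.store n) _ hx, initFrom,
      Pi.add_apply, slotWrite_apply, if_pos (Set.mem_range_self _), add_zero]
  exact ⟨(Layout.isCoded_encode ha _ _).congr hc,
    (Layout.decode_congr hc).trans (Layout.decode_encode ha _ _)⟩

theorem isFaithful (ha : 0 < a) :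
    π.scheme.IsFaithful fun s => Λ.IsCoded (π.contents s) := by
  have hstep : ∀ s θ z A Δ, Λ.IsCoded (π.contents s) → ∀ n (x : Fin M × Λ.Chunk),
      n ∈ Λ.B x.2.1 → π.contents (fun n => π.scheme.refresh n (s n) (π.scheme.query θ z n)
        (π.scheme.upload θ z A Δ n)) n x = π.contents s n x +
      Λ.increment n (Λ.share θ (z ∘ π.eU ∘ Sum.inl) n)
        (Λ.mask θ (z ∘ π.eU ∘ Sum.inl) (z ∘ π.eU ∘ Sum.inr ∘ Sum.inl)
          (z ∘ π.eU ∘ Sum.inr ∘ Sum.inr) n)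
        (Λ.combine (z ∘ π.eU ∘ Sum.inr ∘ Sum.inl) (π.extend Δ) n) x := by
    intro s θ z A Δ hs n x hx
    unfold contents
    refine (slotRead_of_pos (p := fun x : Fin M × Λ.Chunk => n ∈ Λ.B x.2.1) (π.store n) _ hx).trans
      ?_
    rw [slotRead_of_pos (p := fun x : Fin M × Λ.Chunk => n ∈ Λ.B x.2.1) (π.store n) (s n) hx]
    refine congrArg (s n (π.store n ⟨x, hx⟩) + ·) ?_
    refine (slotWrite_apply (π.store n) _ _).trans ?_
    refine (π.increment_slotRead n _ _ _ hx).trans ?_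
    simp only [scheme, queryFrom, Function.comp_def, Equiv.symm_apply_apply, Sum.elim_inl,
      Sum.elim_inr]
    rfl
  refine ⟨fun W z => (contents_init ha W _).1, fun W z => ?_, fun s θ z A Δ hs => ?_,
    fun s θ z A Δ hs m => ?_, ?_⟩
  · funext m l
    exact (congrFun (congrFun (contents_init ha W _).2 m) _).trans (π.extend_sym _ _)
  · exact (Layout.isCoded_increment ha hs θ _ _ _ _ (hstep s θ z A Δ hs)).1
  · have h := (Layout.isCoded_increment ha hs θ _ _ _ _ (hstep s θ z A Δ hs)).2
    funext l
    refine (h m (π.sym l)).trans ?_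
    split_ifs
    · exact congrArg _ (π.extend_sym Δ l)
    · exact add_zero _
  · refine ⟨fun A l => Λ.decodeReply (fun n => slotRead (π.ans n) (A n)) (π.sym l),
      fun s θ z hs => ?_⟩
    funext l
    refine congrFun (Layout.decodeReply_reply hs θ (z ∘ π.eU ∘ Sum.inl) fun n y hy => ?_) _
    refine (slotRead_slotWrite (p := fun y : P × Fin a => n ∈ Λ.B y.1) (π.ans n) _ hy).trans ?_
    simp only [scheme, queryFrom, Function.comp_def, Equiv.symm_apply_apply, Sum.elim_inl,
      contents]
    rfl

end Placement

/-- Every list of parts that use `a + 2 * ℓ p` databases and carry `a * ℓ p` symbols each gives a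
valid and full scheme over every field with enough points: database `n` holds `M * ℓ p` symbols of
each of its parts, and sends and receives `a` symbols for each of them. Longer arrays than these
are filled up, the contents with noise and the messages with zeros. -/
theorem exists_scheme_of_parts {F : Type*} [Field F] [Fintype F] {N a : ℕ} (ha : 0 < a)
    {P : Type*} [Fintype P] (B : P → Finset (Fin N)) (ℓ : P → ℕ)
    (hB : ∀ p, (B p).card = a + 2 * ℓ p) (hq : N + N * a ≤ Fintype.card F) {M L : ℕ}
    (storeLen answerLen updateLen : Fin N → ℕ) (hL : L ≤ (∑ p, ℓ p) * a)
    (hstore : ∀ n, M * ∑ p with n ∈ B p, ℓ p ≤ storeLen n)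
    (hans : ∀ n, (∑ p with n ∈ B p, 1) * a ≤ answerLen n)
    (hupd : ∀ n, (∑ p with n ∈ B p, 1) * a ≤ updateLen n) :
    ∃ σ : Scheme F N M L, σ.IsValid ∧ σ.IsFull ∧ σ.storeLen = storeLen ∧
      σ.answerLen = answerLen ∧ σ.updateLen = updateLen := by
  have hℓ : ∀ p, ℓ p ≤ N := fun p => by
    have := (Finset.card_le_univ (B p)).trans_eq (Fintype.card_fin N)
    have := hB p
    omega
  obtain ⟨ι⟩ : Nonempty (Fin N ⊕ Fin N × Fin a ↪ F) :=
    Function.Embedding.nonempty_of_card_le (by simpa using hq)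
  let Λ : Layout F N a P :=
    { B := B
      ℓ := ℓ
      card_B := hB
      α := fun n => ι (Sum.inl n)
      α_injective := fun n n' h => Sum.inl_injective (ι.injective h)
      f := fun p i j => ι (Sum.inr (Fin.castLE (hℓ p) i, j))
      f_injective := fun p x y h => by
        have h' := Prod.mk.inj (Sum.inr_injective (ι.injective h))
        exact Prod.ext (Fin.castLE_injective (hℓ p) h'.1) h'.2
      α_ne_f := fun n p i j h => Sum.inl_ne_inr (ι.injective h) }
  have hsum : ∀ (n : Fin N) (g : P → ℕ), ∑ p : {p // n ∈ B p}, g p = ∑ p with n ∈ B p, g p :=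
    fun n g => (Finset.sum_subtype _ (by simp) g).symm
  have hstore' : ∀ n, Nonempty ({x : Fin M × Λ.Chunk // n ∈ Λ.B x.2.1} ↪ Fin (storeLen n)) := by
    intro n
    refine Function.Embedding.nonempty_of_card_le ?_
    rw [Fintype.card_fin]
    refine le_trans ?_ (hstore n)
    refine (Fintype.card_le_of_injective
      (β := Fin M × Σ p : {p // n ∈ B p}, Fin (ℓ p))
      (fun x => (x.1.1, ⟨⟨x.1.2.1, x.2⟩, x.1.2.2⟩)) ?_).trans_eq ?_
    · rintro ⟨⟨m, ⟨p, i⟩⟩, hx⟩ ⟨⟨m', ⟨p', i'⟩⟩, hx'⟩ h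
      simp only [Prod.mk.injEq, Sigma.mk.injEq, Subtype.mk.injEq] at h
      obtain ⟨rfl, rfl, h⟩ := h
      simp_all
    · simp [hsum]
  have hmsg : ∀ n l, (∑ p with n ∈ B p, 1) * a ≤ l →
      Nonempty ({y : P × Fin a // n ∈ Λ.B y.1} ↪ Fin l) := by
    intro n l hl
    refine Function.Embedding.nonempty_of_card_le ?_
    rw [Fintype.card_fin]
    refine le_trans ?_ hl
    refine (Fintype.card_le_of_injective (β := {p // n ∈ B p} × Fin a)
      (fun y => (⟨y.1.1, y.2⟩, y.1.2)) ?_).trans_eq ?_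
    · rintro ⟨⟨p, j⟩, hy⟩ ⟨⟨p', j'⟩, hy'⟩ h
      simp_all
    · rw [Fintype.card_prod, Fintype.card_fin, ← hsum n (fun _ => 1)]
      simp
  obtain ⟨sym⟩ : Nonempty (Fin L ↪ Λ.Sym) :=
    Function.Embedding.nonempty_of_card_le (by simpa [Λ] using hL)
  let π : Placement Λ M L :=
    { sym := sym
      storeLen := storeLen
      answerLen := answerLen
      updateLen := updateLen
      store := fun n => (hstore' n).some
      ans := fun n => (hmsg n _ (hans n)).some
      upd := fun n => (hmsg n _ (hupd n)).some }
  exact ⟨π.scheme, π.isMasked.isValid (Placement.isFaithful ha), π.isMasked.isFull, rfl, rfl, rfl⟩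

end PRUW

end

namespace PRUW

/-! ### Convex decomposition of a storage profile into sets of databases -/

section Decomposition

variable {ι : Type*} [Fintype ι] [DecidableEq ι] (S : Subfield ℝ) (b : ℕ)

/-- `x` is a convex combination, with coefficients in the field `S`, of the indicator vectors of
sets with `b` or `b + 1` elements. -/
def IsMixture (x : ι → ℝ) : Prop :=
  ∃ w : Finset ι → ℝ, (∀ B, 0 ≤ w B) ∧ (∀ B, w B ∈ S) ∧ ∑ B, w B = 1 ∧
    (∀ n, ∑ B with n ∈ B, w B = x n) ∧ ∀ B, w B ≠ 0 → B.card = b ∨ B.card = b + 1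

variable {S b}

theorem isMixture_indicator (A : Finset ι) (hA : A.card = b ∨ A.card = b + 1) :
    IsMixture S b fun n => if n ∈ A then 1 else 0 := by
  refine ⟨fun B => if B = A then 1 else 0, fun B => ?_, fun B => ?_, by simp, fun n => ?_,
    fun B hB => ?_⟩
  · dsimp only
    split_ifs <;> norm_num
  · dsimp only
    split_ifs
    exacts [S.one_mem, S.zero_mem]
  · rw [Finset.sum_ite_eq' (Finset.univ.filter fun B => n ∈ B) A fun _ => (1 : ℝ)]
    simp
  · dsimp only at hB
    rw [ite_ne_right_iff] at hB
    rwa [hB.1]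

theorem IsMixture.add {x y : ι → ℝ} (hx : IsMixture S b x) (hy : IsMixture S b y) {u v : ℝ}
    (hu : 0 ≤ u) (hv : 0 ≤ v) (huS : u ∈ S) (hvS : v ∈ S) (huv : u + v = 1) :
    IsMixture S b fun n => u * x n + v * y n := by
  obtain ⟨w, h0, h1, h2, h3, h4⟩ := hx
  obtain ⟨w', h0', h1', h2', h3', h4'⟩ := hy
  refine ⟨fun B => u * w B + v * w' B, fun B => ?_, fun B => ?_, ?_, fun n => ?_, fun B hB => ?_⟩
  · have := h0 B
    have := h0' B
    positivity
  · exact S.add_mem (S.mul_mem huS (h1 B)) (S.mul_mem hvS (h1' B))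
  · rw [Finset.sum_add_distrib, ← Finset.mul_sum, ← Finset.mul_sum, h2, h2', mul_one, mul_one, huv]
  · rw [Finset.sum_add_distrib, ← Finset.mul_sum, ← Finset.mul_sum, h3, h3']
  · by_cases hB' : w B = 0
    · refine h4' B fun h => hB ?_
      simp [hB', h]
    · exact h4 B hB'

/-- Move weight from the fractional coordinate `j` to the fractional coordinate `i` until one of
the two becomes integral. -/
theorem exists_shift {x : ι → ℝ} (h0 : ∀ n, 0 ≤ x n) (h1 : ∀ n, x n ≤ 1) (hS : ∀ n, x n ∈ S)
    {i j : ι} (hij : i ≠ j) (hi : 0 < x i ∧ x i < 1) (hj : 0 < x j ∧ x j < 1) :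
    ∃ d : ℝ, 0 < d ∧ d ∈ S ∧ ∃ y : ι → ℝ, (∀ n, 0 ≤ y n) ∧ (∀ n, y n ≤ 1) ∧ (∀ n, y n ∈ S) ∧
      (∀ n, y n = x n + d * ((if n = i then 1 else 0) - if n = j then 1 else 0)) ∧
      (Finset.univ.filter fun n => 0 < y n ∧ y n < 1) ⊂
        Finset.univ.filter fun n => 0 < x n ∧ x n < 1 := by
  obtain ⟨d, hd, hdS, hdi, hdj, hor⟩ : ∃ d : ℝ, 0 < d ∧ d ∈ S ∧ x i + d ≤ 1 ∧ 0 ≤ x j - d ∧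
      (x i + d = 1 ∨ x j - d = 0) := by
    rcases le_total (1 - x i) (x j) with h | h
    · exact ⟨1 - x i, by linarith, S.sub_mem S.one_mem (hS i), by linarith, by linarith,
        Or.inl (by ring)⟩
    · exact ⟨x j, by linarith, hS j, by linarith, by linarith, Or.inr (by ring)⟩
  refine ⟨d, hd, hdS, fun n => x n + d * ((if n = i then 1 else 0) - if n = j then 1 else 0),
    fun n => ?_, fun n => ?_, fun n => ?_, fun n => rfl, ?_⟩
  · have := h0 n
    dsimp only
    split_ifs with h h' h' <;> subst_vars <;> first | exact absurd rfl hij | linarith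
  · have := h1 n
    dsimp only
    split_ifs with h h' h' <;> subst_vars <;> first | exact absurd rfl hij | linarith
  · refine S.add_mem (hS n) (S.mul_mem hdS (S.sub_mem ?_ ?_)) <;> split_ifs <;>
      first | exact S.one_mem | exact S.zero_mem
  · have hsub : (Finset.univ.filter fun n => 0 < x n + d * ((if n = i then 1 else 0) -
        if n = j then 1 else 0) ∧ x n + d * ((if n = i then 1 else 0) -
        if n = j then 1 else 0) < 1) ⊆ Finset.univ.filter fun n => 0 < x n ∧ x n < 1 := by
      intro n
      simp only [Finset.mem_filter, Finset.mem_univ, true_and]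
      by_cases hni : n = i
      · subst hni
        exact fun _ => hi
      by_cases hnj : n = j
      · subst hnj
        exact fun _ => hj
      simp [hni, hnj]
    refine Finset.ssubset_iff_subset_ne.mpr ⟨hsub, fun heq => ?_⟩
    rcases hor with h | h
    · have : i ∈ Finset.univ.filter fun n => 0 < x n ∧ x n < 1 := by simpa using hi
      rw [← heq] at this
      simp [hij] at this
      linarith
    · have : j ∈ Finset.univ.filter fun n => 0 < x n ∧ x n < 1 := by simpa using hj
      rw [← heq] at this
      simp [hij.symm] at this
      linarith

theorem isMixture_of_sum_mem_Icc (x : ι → ℝ) (h0 : ∀ n, 0 ≤ x n) (h1 : ∀ n, x n ≤ 1)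
    (hS : ∀ n, x n ∈ S) (hb : (b : ℝ) ≤ ∑ n, x n) (hb' : ∑ n, x n ≤ b + 1) :
    IsMixture S b x := by
  induction hfr : Finset.univ.filter (fun n => 0 < x n ∧ x n < 1) using
    Finset.strongInduction generalizing x with
  | H fr ih =>
    subst hfr
    by_cases htwo : ∃ i j, i ≠ j ∧ (0 < x i ∧ x i < 1) ∧ (0 < x j ∧ x j < 1)
    · obtain ⟨i, j, hij, hi, hj⟩ := htwo
      obtain ⟨d, hd, hdS, y, hy0, hy1, hyS, hy, hyfr⟩ := exists_shift h0 h1 hS hij hi hj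
      obtain ⟨d', hd', hdS', y', hy0', hy1', hyS', hy', hyfr'⟩ :=
        exists_shift h0 h1 hS hij.symm hj hi
      have hsum : ∑ n, y n = ∑ n, x n := by
        simp [hy, Finset.sum_add_distrib, ← Finset.mul_sum]
      have hsum' : ∑ n, y' n = ∑ n, x n := by
        simp [hy', Finset.sum_add_distrib, ← Finset.mul_sum]
      have hm := (ih _ hyfr y hy0 hy1 hyS (hsum ▸ hb) (hsum ▸ hb') rfl).add
        (ih _ hyfr' y' hy0' hy1' hyS' (hsum' ▸ hb) (hsum' ▸ hb') rfl)
        (u := d' / (d + d')) (v := d / (d + d')) (by positivity) (by positivity)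
        (S.div_mem hdS' (S.add_mem hdS hdS')) (S.div_mem hdS (S.add_mem hdS hdS'))
        (by field_simp; ring)
      convert hm using 1
      funext n
      rw [hy, hy']
      field_simp
      ring
    · push Not at htwo
      have hdich : ∀ n, ¬(0 < x n ∧ x n < 1) → x n = 0 ∨ x n = 1 := fun n hn => by
        by_contra! h
        exact hn ⟨lt_of_le_of_ne (h0 n) h.1.symm, lt_of_le_of_ne (h1 n) h.2⟩
      by_cases hone : ∃ i, 0 < x i ∧ x i < 1
      · obtain ⟨i, hi⟩ := hone
        have hrest : ∀ n, n ≠ i → x n = 0 ∨ x n = 1 := fun n hn =>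
          hdich n fun h => absurd h.2 (not_lt.mpr (htwo i n hn.symm hi h.1))
        set A := Finset.univ.filter fun n => x n = 1 with hA
        have hiA : i ∉ A := by simp [hA, hi.2.ne]
        have hxA : ∀ n, x n = (if n ∈ A then 1 else 0) + x i * if n = i then 1 else 0 := by
          intro n
          by_cases hn : n = i
          · subst hn
            simp [hiA]
          · rcases hrest n hn with h | h <;> simp [hA, h, hn]
        have hsum : ∑ n, x n = A.card + x i := by
          rw [Finset.sum_congr rfl fun n _ => hxA n, Finset.sum_add_distrib, ← Finset.mul_sum]
          simp
        have hcard : A.card = b := by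
          rw [hsum] at hb hb'
          have h1 : b < A.card + 1 := by exact_mod_cast (by linarith [hi.2] : (b : ℝ) < A.card + 1)
          have h2 : A.card < b + 1 := by exact_mod_cast (by linarith [hi.1] : (A.card : ℝ) < b + 1)
          omega
        have hm := (isMixture_indicator (S := S) (b := b) A (Or.inl hcard)).add
          (isMixture_indicator (insert i A)
            (Or.inr (by rw [Finset.card_insert_of_notMem hiA, hcard])))
          (u := 1 - x i) (v := x i) (by linarith) hi.1.le (S.sub_mem S.one_mem (hS i)) (hS i)
          (by ring)
        convert hm using 1
        funext n
        by_cases hn : n = i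
        · subst hn
          simp [hiA]
        · rw [hxA n]
          simp [hn]
          split_ifs <;> ring
      · push Not at hone
        set A := Finset.univ.filter fun n => x n = 1 with hA
        have hxA : x = fun n => if n ∈ A then 1 else 0 := by
          funext n
          rcases hdich n fun h => absurd h.2 (not_lt.mpr (hone n h.1)) with h | h <;> simp [hA, h]
        rw [hxA]
        refine isMixture_indicator A ?_
        have hsum : ∑ n, x n = A.card := by
          rw [hxA]
          simp
        rw [hsum] at hb hb'
        have h1 : b ≤ A.card := by exact_mod_cast hb
        have h2 : A.card ≤ b + 1 := by exact_mod_cast hb'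
        omega

end Decomposition
end PRUW

noncomputable section

namespace PRUW

/-! ### Comparison of costs -/

/-- The number of symbols sent per symbol of a submodel by a code that stores `a` symbols in one
on at most `b` databases: it uses `a + 2 * ℓ` of them with `ℓ = (b - a) / 2` rounded down. The value
is meaningful for `a + 2 ≤ b` only. -/
def codeCost (a b : ℕ) : ℝ := 2 * (a + 2 * ((b - a) / 2 : ℕ)) / ((b - a) / 2 : ℕ)

theorem codeCost_add_two_mul (a l : ℕ) : codeCost a (a + 2 * l) = 2 * (a + 2 * l) / l := by
  unfold codeCost
  rw [Nat.add_sub_cancel_left, Nat.mul_div_cancel_left _ two_pos]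

theorem codeCost_add_two_mul_add_one (a l : ℕ) :
    codeCost a (a + 2 * l + 1) = 2 * (a + 2 * l) / l := by
  unfold codeCost
  rw [show (a + 2 * l + 1 - a) / 2 = l by omega]

theorem CT_of_lt {a b : ℕ} (h : b < a + 3) : CT a b = ⊤ := if_neg (by omega)

theorem CT_odd (a l : ℕ) :
    CT a (a + 2 * (l + 1) + 1) =
      ENNReal.ofReal (4 * (a + 2 * (l + 1) + 1) / (2 * (l + 1))) := by
  unfold CT
  rw [if_pos (by omega), if_pos ⟨l + 1, by omega⟩]
  congr 1
  push_cast
  congr 1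
  ring

theorem CT_even (a l : ℕ) :
    CT a (a + 2 * (l + 2)) = ENNReal.ofReal ((4 * (a + 2 * (l + 2)) - 2) / (2 * (l + 1))) := by
  unfold CT
  rw [if_pos (by omega), if_neg (by rw [Nat.not_odd_iff_even]; exact ⟨l + 2, by omega⟩)]
  congr 1
  push_cast
  congr 1
  ring

theorem codeCost_le_CT (a b : ℕ) : ENNReal.ofReal (codeCost a b) ≤ CT a b := by
  rcases lt_or_ge b (a + 3) with h | h
  · rw [CT_of_lt h]
    exact le_top
  obtain ⟨l, rfl | rfl⟩ : ∃ l, b = a + 2 * (l + 1) + 1 ∨ b = a + 2 * (l + 2) := by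
    rcases Nat.even_or_odd' (b - a) with ⟨m, hm | hm⟩
    · exact ⟨m - 2, Or.inr (by omega)⟩
    · exact ⟨m - 1, Or.inl (by omega)⟩
  · rw [CT_odd, codeCost_add_two_mul_add_one]
    refine ENNReal.ofReal_le_ofReal ?_
    push_cast
    rw [div_le_div_iff₀ (by positivity) (by positivity)]
    nlinarith [(Nat.cast_nonneg l : (0 : ℝ) ≤ l), (Nat.cast_nonneg a : (0 : ℝ) ≤ a)]
  · rw [CT_even, codeCost_add_two_mul]
    refine ENNReal.ofReal_le_ofReal ?_
    push_cast
    rw [div_le_div_iff₀ (by positivity) (by positivity)]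
    nlinarith [(Nat.cast_nonneg l : (0 : ℝ) ≤ l), (Nat.cast_nonneg a : (0 : ℝ) ≤ a),
      mul_nonneg (Nat.cast_nonneg l : (0 : ℝ) ≤ l) (Nat.cast_nonneg a : (0 : ℝ) ≤ a)]

/-- If `b - a` is odd, the code `(a + 1, b)` costs at most `C_T` for all roundings up of `a` and
`b`. -/
theorem codeCost_succ_le_CT_of_odd {a a' b b' l : ℕ} (hb : b = a + 2 * (l + 1) + 1)
    (ha' : a' = a ∨ a' = a + 1) (hb' : b' = b ∨ b' = b + 1) :
    ENNReal.ofReal (codeCost (a + 1) b) ≤ CT a' b' := by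
  subst hb
  have hl : (0 : ℝ) ≤ l := Nat.cast_nonneg l
  have ha : (0 : ℝ) ≤ a := Nat.cast_nonneg a
  have hla := mul_nonneg hl ha
  rw [show a + 2 * (l + 1) + 1 = a + 1 + 2 * (l + 1) by ring, codeCost_add_two_mul] at *
  rcases ha' with rfl | rfl <;> rcases hb' with rfl | rfl
  · rw [show a' + 1 + 2 * (l + 1) = a' + 2 * (l + 1) + 1 by ring, CT_odd]
    refine ENNReal.ofReal_le_ofReal ?_
    push_cast
    rw [div_le_div_iff₀ (by positivity) (by positivity)]
    nlinarith
  · rw [show a' + 1 + 2 * (l + 1) + 1 = a' + 2 * (l + 2) by ring, CT_even]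
    refine ENNReal.ofReal_le_ofReal ?_
    push_cast
    rw [div_le_div_iff₀ (by positivity) (by positivity)]
    nlinarith
  · rcases l with - | l
    · rw [CT_of_lt (by omega)]
      exact le_top
    · rw [show a + 1 + 2 * (l + 1 + 1) = a + 1 + 2 * (l + 2) by ring, CT_even]
      refine ENNReal.ofReal_le_ofReal ?_
      push_cast at *
      rw [div_le_div_iff₀ (by positivity) (by positivity)]
      nlinarith
  · rw [CT_odd]
    refine ENNReal.ofReal_le_ofReal ?_
    push_cast
    rw [div_le_div_iff₀ (by positivity) (by positivity)]
    nlinarith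

theorem codeCost_succ_le_CT_of_even {a a' b l : ℕ} (hb : b = a + 2 * (l + 2))
    (ha' : a' = a ∨ a' = a + 1) : ENNReal.ofReal (codeCost (a + 1) b) ≤ CT a' b := by
  subst hb
  have hl : (0 : ℝ) ≤ l := Nat.cast_nonneg l
  have ha : (0 : ℝ) ≤ a := Nat.cast_nonneg a
  have hla := mul_nonneg hl ha
  rw [show a + 2 * (l + 2) = a + 1 + 2 * (l + 1) + 1 by ring, codeCost_add_two_mul_add_one] at *
  rcases ha' with rfl | rfl
  · rw [show a' + 1 + 2 * (l + 1) + 1 = a' + 2 * (l + 2) by ring, CT_even]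
    refine ENNReal.ofReal_le_ofReal ?_
    push_cast
    rw [div_le_div_iff₀ (by positivity) (by positivity)]
    nlinarith
  · rw [CT_odd]
    refine ENNReal.ofReal_le_ofReal ?_
    push_cast
    rw [div_le_div_iff₀ (by positivity) (by positivity)]
    nlinarith

theorem codeCost_succ_succ_le_CT_of_even {a b l : ℕ} (hb : b = a + 2 * (l + 2)) :
    ENNReal.ofReal (codeCost (a + 1) (b + 1)) ≤ CT a (b + 1) := by
  subst hb
  have hl : (0 : ℝ) ≤ l := Nat.cast_nonneg l
  have ha : (0 : ℝ) ≤ a := Nat.cast_nonneg a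
  rw [show a + 2 * (l + 2) + 1 = a + 1 + 2 * (l + 2) by ring, codeCost_add_two_mul,
    show a + 1 + 2 * (l + 2) = a + 2 * (l + 1 + 1) + 1 by ring, CT_odd]
  refine ENNReal.ofReal_le_ofReal ?_
  push_cast
  rw [div_le_div_iff₀ (by positivity) (by positivity)]
  nlinarith

theorem codeCost_succ_le {a b : ℕ} (h : a + 2 ≤ b) : codeCost a (b + 1) ≤ codeCost a b := by
  obtain ⟨l, rfl | rfl⟩ : ∃ l, b = a + 2 * (l + 1) ∨ b = a + 2 * (l + 1) + 1 := by
    rcases Nat.even_or_odd' (b - a) with ⟨m, hm | hm⟩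
    · exact ⟨m - 1, Or.inl (by omega)⟩
    · exact ⟨m - 1, Or.inr (by omega)⟩
  · rw [codeCost_add_two_mul_add_one, codeCost_add_two_mul]
  · rw [codeCost_add_two_mul_add_one, show a + 2 * (l + 1) + 1 + 1 = a + 2 * (l + 2) by ring,
      codeCost_add_two_mul]
    push_cast
    rw [div_le_div_iff₀ (by positivity) (by positivity)]
    nlinarith [(Nat.cast_nonneg l : (0 : ℝ) ≤ l), (Nat.cast_nonneg a : (0 : ℝ) ≤ a)]

section Params

variable {N : ℕ} {μ : Fin N → ℝ}

theorem one_le_ofReal_weights (u v w : ℝ) : 1 ≤ ENNReal.ofReal (u * v) +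
    ENNReal.ofReal (u * (1 - v)) + ENNReal.ofReal ((1 - u) * w) +
      ENNReal.ofReal ((1 - u) * (1 - w)) := by
  calc (1 : ℝ≥0∞) = ENNReal.ofReal (u * v + u * (1 - v) + (1 - u) * w + (1 - u) * (1 - w)) := by
        rw [show u * v + u * (1 - v) + (1 - u) * w + (1 - u) * (1 - w) = 1 by ring,
          ENNReal.ofReal_one]
    _ ≤ _ := by
      refine ENNReal.ofReal_add_le.trans ?_
      gcongr
      refine ENNReal.ofReal_add_le.trans ?_
      gcongr
      exact ENNReal.ofReal_add_le

theorem le_C₂ {c : ℝ≥0∞} (h₁ : c ≤ CT ⌊kk μ⌋₊ ⌊rr μ⌋₊) (h₂ : c ≤ CT ⌊kk μ⌋₊ ⌈rr μ⌉₊)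
    (h₃ : c ≤ CT ⌈kk μ⌉₊ ⌊rr μ⌋₊) (h₄ : c ≤ CT ⌈kk μ⌉₊ ⌈rr μ⌉₊) : c ≤ C₂ μ := by
  calc c = 1 * c := (one_mul c).symm
    _ ≤ _ := mul_le_mul_left (one_le_ofReal_weights (alphaW μ) (betaW μ) (deltaW μ)) c
    _ ≤ C₂ μ := by
      unfold C₂
      rw [add_mul, add_mul, add_mul]
      gcongr

/-- A weighted sum with weights `w₁`, `w₂`, `w₃` of total at least one is at least the
interpolation of `c₁` and `c₂` if the weight of the smaller value `c₂` is at most `ρ`. -/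
theorem interpolation_le {c₁ c₂ w₁ w₂ w₃ : ℝ≥0∞} {ρ : ℝ} (hρ : 0 ≤ ρ) (hρ1 : ρ ≤ 1)
    (hw : 1 ≤ w₁ + w₂ + w₃) (hw₂ : w₂ ≤ ENNReal.ofReal ρ) (hc : c₂ ≤ c₁) :
    ENNReal.ofReal (1 - ρ) * c₁ + ENNReal.ofReal ρ * c₂ ≤ w₁ * c₁ + w₂ * c₂ + w₃ * c₁ := by
  have h1 : ENNReal.ofReal (1 - ρ) + (ENNReal.ofReal ρ - w₂) ≤ w₁ + w₃ := by
    have hfin : w₂ ≠ ⊤ := (hw₂.trans_lt ENNReal.ofReal_lt_top).ne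
    rw [← ENNReal.add_le_add_iff_right hfin, add_assoc, tsub_add_cancel_of_le hw₂,
      ← ENNReal.ofReal_add (by linarith) hρ, sub_add_cancel, ENNReal.ofReal_one]
    exact hw.trans_eq (by ring)
  calc ENNReal.ofReal (1 - ρ) * c₁ + ENNReal.ofReal ρ * c₂
      = ENNReal.ofReal (1 - ρ) * c₁ + (ENNReal.ofReal ρ - w₂) * c₂ + w₂ * c₂ := by
        rw [add_assoc, ← add_mul, tsub_add_cancel_of_le hw₂]
    _ ≤ ENNReal.ofReal (1 - ρ) * c₁ + (ENNReal.ofReal ρ - w₂) * c₁ + w₂ * c₂ := by gcongr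
    _ ≤ (w₁ + w₃) * c₁ + w₂ * c₂ := by
        rw [← add_mul]
        gcongr
    _ = w₁ * c₁ + w₂ * c₂ + w₃ * c₁ := by ring

theorem exists_kk_eq (hμpos : ∃ n, 0 < μ n) : ∃ n, 0 < μ n ∧ kk μ = 1 / μ n ∧ ∀ m, μ m ≤ μ n := by
  obtain ⟨n₀, hn₀⟩ := hμpos
  have : Nonempty (Fin N) := ⟨n₀⟩
  obtain ⟨n, hn⟩ := exists_eq_ciSup_of_finite (f := μ)
  have hle : ∀ m, μ m ≤ μ n := fun m => by
    rw [hn]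
    exact le_ciSup (Set.finite_range μ).bddAbove m
  exact ⟨n, hn₀.trans_le (hle n₀), by rw [kk, hn], hle⟩

theorem one_le_kk (hμ1 : ∀ n, μ n ≤ 1) (hμpos : ∃ n, 0 < μ n) : 1 ≤ kk μ := by
  obtain ⟨n, hn, h, -⟩ := exists_kk_eq hμpos
  rw [h]
  exact (one_le_div hn).mpr (hμ1 n)

theorem kk_mul_le_one (hμpos : ∃ n, 0 < μ n) (m : Fin N) : kk μ * μ m ≤ 1 := by
  obtain ⟨n, hn, h, hle⟩ := exists_kk_eq hμpos
  rw [h, one_div, inv_mul_le_iff₀ hn, mul_one]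
  exact hle m

theorem kk_mem {S : Subfield ℝ} (hS : ∀ n, μ n ∈ S) (hμpos : ∃ n, 0 < μ n) : kk μ ∈ S := by
  obtain ⟨n, -, h, -⟩ := exists_kk_eq hμpos
  rw [h]
  exact S.div_mem S.one_mem (hS n)

theorem ceil_eq_or (x : ℝ) (hx : 0 ≤ x) :
    ⌈x⌉₊ = ⌊x⌋₊ ∧ x = ⌊x⌋₊ ∨ ⌈x⌉₊ = ⌊x⌋₊ + 1 ∧ (⌊x⌋₊ : ℝ) < x := by
  rcases (Nat.floor_le hx).eq_or_lt with h | h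
  · left
    refine ⟨?_, h.symm⟩
    conv_lhs => rw [← h]
    exact Nat.ceil_natCast _
  · right
    refine ⟨?_, h⟩
    refine le_antisymm (Nat.ceil_le_floor_add_one x) ?_
    exact Nat.succ_le_of_lt (by exact_mod_cast h.trans_le (Nat.le_ceil x))

/-- For even `⌊r⌋ - ⌊k⌋` the code `(⌊k⌋, ⌈r⌉)`, the only one in `C₂` that can be cheaper than
`(⌊k⌋ + 1, ⌊r⌋)`, has at most the fractional part of `r` as weight. -/
theorem alphaW_mul_le (hμ0 : ∀ n, 0 ≤ μ n) (hμ1 : ∀ n, μ n ≤ 1) (hμpos : ∃ n, 0 < μ n)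
    (hodd : ¬OddCase μ) : alphaW μ * (1 - betaW μ) ≤ rr μ - ⌊rr μ⌋₊ := by
  have hk1 := one_le_kk hμ1 hμpos
  have hk0 : 0 < kk μ := by linarith
  have hp : 0 ≤ pp μ := Finset.sum_nonneg fun n _ => hμ0 n
  have hr0 : 0 ≤ rr μ := mul_nonneg hk0.le hp
  have hR := Nat.floor_le hr0
  have hR' := Nat.lt_floor_add_one (rr μ)
  have hK := Nat.floor_le hk0.le
  have hK1 : 1 ≤ ⌊kk μ⌋₊ := Nat.le_floor (by simpa using hk1)
  have hK1' : (1 : ℝ) ≤ ⌊kk μ⌋₊ := by exact_mod_cast hK1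
  have hKp : pp μ = rr μ / kk μ := by
    rw [rr]
    field_simp
  unfold alphaW betaW
  rw [if_neg hodd, if_neg hodd]
  split_ifs with h
  · have hc : 0 < (⌈kk μ⌉₊ : ℝ) - kk μ := by linarith
    rw [sub_sub_cancel]
    have : (⌊kk μ⌋₊ : ℝ) / kk μ * (⌈kk μ⌉₊ - kk μ) * ((rr μ - ⌊rr μ⌋₊) / (⌈kk μ⌉₊ - kk μ)) =
        ⌊kk μ⌋₊ / kk μ * (rr μ - ⌊rr μ⌋₊) := by
      field_simp
    rw [this]
    refine mul_le_of_le_one_left (by linarith) ?_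
    exact (div_le_one hk0).mpr hK
  · rw [sub_zero, mul_one]
    push Not at h
    rcases ceil_eq_or (kk μ) hk0.le with ⟨hc, hkk⟩ | ⟨hc, hkk⟩
    · have hrr : pp μ * ⌈kk μ⌉₊ = rr μ := by rw [hc, ← hkk, rr, mul_comm]
      rw [hrr, hc]
      rcases ceil_eq_or (rr μ) hr0 with ⟨hc', -⟩ | ⟨hc', -⟩
      · rw [hc', sub_self, div_zero]
        linarith
      · rw [hc', ← mul_sub, mul_div_mul_left _ _ (by positivity)]
        push_cast
        simp
    · rw [hc] at h ⊢
      push_cast at h ⊢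
      have hk2 := Nat.lt_floor_add_one (kk μ)
      have hc' : ⌈rr μ⌉₊ = ⌊rr μ⌋₊ + 1 := by
        rcases ceil_eq_or (rr μ) hr0 with ⟨-, h'⟩ | ⟨h', -⟩
        · linarith
        · exact h'
      rw [hc', hKp]
      push_cast
      generalize hKdef : ((⌊kk μ⌋₊ : ℕ) : ℝ) = K at *
      generalize hRdef : ((⌊rr μ⌋₊ : ℕ) : ℝ) = R at *
      generalize kk μ = k at *
      generalize rr μ = r at *
      have hR0 : 0 ≤ R := by rw [← hRdef]; positivity
      have hden : 0 < (K + 1) * (R + 1) - K * R := by nlinarith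
      rw [div_le_iff₀ hden]
      -- For `ρ = r - R`, the smallest possible `k` is `K + 1 - ρ`. There the two sides are
      -- `K * (ρ * (K + R + 1))` and `(K + 1 - ρ) * (ρ * (K + R + 1))`, and as `k` grows, the left
      -- side falls and the right side rises.
      have hkey : K * (r * (K + 1) - R * k) ≤ (r - R) * ((K + 1) * (R + 1) - K * R) * k := by
        have h1 : 0 ≤ (k - (K + 1 - (r - R))) := by linarith
        have h2 : 0 ≤ r - R := by linarith
        have h3 : 0 ≤ 1 - (r - R) := by linarith
        have hK0 : 0 ≤ K := by linarith
        nlinarith [mul_nonneg h1 (mul_nonneg hK0 hR0), mul_nonneg h1 (mul_nonneg h2 hR0),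
          mul_nonneg h1 (mul_nonneg h2 hK0), mul_nonneg h1 h2,
          mul_nonneg (mul_nonneg h2 h3) hR0, mul_nonneg (mul_nonneg h2 h3) hK0,
          mul_nonneg h2 h3]
      have : K * (r / k * (K + 1) - R) = K * (r * (K + 1) - R * k) / k := by
        field_simp
      rw [this, div_le_iff₀ hk0]
      exact hkey

/-- A storage profile `x` for codes that store `a` symbols in one, such that the interpolated cost
of these codes does not exceed `C`. -/
theorem exists_profile (hμ0 : ∀ n, 0 ≤ μ n) (hμ1 : ∀ n, μ n ≤ 1) (hμpos : ∃ n, 0 < μ n)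
    (hC : Cmin μ ≠ ⊤) {S : Subfield ℝ} (hS : ∀ n, μ n ∈ S) :
    ∃ a : ℕ, 0 < a ∧ a ≤ ⌊kk μ⌋₊ + 1 ∧ ∃ x : Fin N → ℝ, (∀ n, 0 ≤ x n) ∧ (∀ n, x n ≤ 1) ∧
      (∀ n, x n ≤ a * μ n) ∧ (∀ n, x n ∈ S) ∧ ∃ b : ℕ, a + 2 ≤ b ∧ (b : ℝ) ≤ ∑ n, x n ∧
        ∑ n, x n ≤ b + 1 ∧ (1 - (∑ n, x n - b)) * codeCost a b +
          (∑ n, x n - b) * codeCost a (b + 1) ≤ (Cmin μ).toReal := by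
  have hk1 := one_le_kk hμ1 hμpos
  have hk0 : 0 < kk μ := by linarith
  have hp : 0 ≤ pp μ := Finset.sum_nonneg fun n _ => hμ0 n
  have hr0 : 0 ≤ rr μ := mul_nonneg hk0.le hp
  have hs0 : 0 ≤ ss μ := mul_nonneg (Nat.cast_nonneg _) hp
  have hK := Nat.floor_le hk0.le
  have hK1 : 1 ≤ ⌊kk μ⌋₊ := Nat.le_floor (by simpa using hk1)
  have hcost : ∀ a b, 0 ≤ codeCost a b := fun a b => by
    unfold codeCost
    positivity
  have hlift : ∀ (ρ : ℝ) (a b : ℕ) (c : ℝ≥0∞), 0 ≤ ρ → ρ ≤ 1 → c ≠ ⊤ →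
      ENNReal.ofReal (1 - ρ) * ENNReal.ofReal (codeCost a b) +
        ENNReal.ofReal ρ * ENNReal.ofReal (codeCost a (b + 1)) ≤ c →
      (1 - ρ) * codeCost a b + ρ * codeCost a (b + 1) ≤ c.toReal := by
    intro ρ a b c h0 h1 hc h
    have h1' : 0 ≤ 1 - ρ := by linarith
    rw [← ENNReal.ofReal_mul h1', ← ENNReal.ofReal_mul h0,
      ← ENNReal.ofReal_add (mul_nonneg h1' (hcost _ _)) (mul_nonneg h0 (hcost _ _))] at h
    exact (ENNReal.ofReal_le_iff_le_toReal hc).mp h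
  rcases min_cases (C₁ μ) (C₂ μ) with ⟨hmin, -⟩ | ⟨hmin, -⟩
  · have hC₁ : Cmin μ = C₁ μ := hmin
    rw [hC₁] at hC ⊢
    have hR := Nat.floor_le hs0
    have hR' := Nat.lt_floor_add_one (ss μ)
    have hsum : ∑ n, (⌊kk μ⌋₊ : ℝ) * μ n = ss μ := by rw [ss, pp, Finset.mul_sum]
    refine ⟨⌊kk μ⌋₊, hK1, Nat.le_succ _, fun n => ⌊kk μ⌋₊ * μ n,
      fun n => mul_nonneg (Nat.cast_nonneg _) (hμ0 n), fun n => ?_, fun n => le_rfl, fun n => ?_,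
      ⌊ss μ⌋₊, ?_, ?_⟩
    · exact (mul_le_mul_of_nonneg_right hK (hμ0 n)).trans (kk_mul_le_one hμpos n)
    · exact S.mul_mem (natCast_mem S _) (hS n)
    · by_contra! hlt
      refine hC ?_
      unfold C₁
      rw [CT_of_lt (by omega), ENNReal.mul_top, top_add]
      rw [Ne, ENNReal.ofReal_eq_zero]
      linarith
    · rw [hsum]
      refine ⟨hR, hR'.le, hlift _ _ _ _ (by linarith) (by linarith) hC ?_⟩
      unfold C₁
      refine add_le_add (mul_le_mul_right (codeCost_le_CT _ _) _) ?_
      rcases ceil_eq_or (ss μ) hs0 with ⟨hc, hss⟩ | ⟨hc, -⟩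
      · rw [sub_eq_zero.mpr hss, ENNReal.ofReal_zero, zero_mul]
        exact zero_le
      · rw [hc]
        exact mul_le_mul_right (codeCost_le_CT _ _) _
  · have hC₂ : Cmin μ = C₂ μ := hmin
    rw [hC₂] at hC ⊢
    have hR := Nat.floor_le hr0
    have hR' := Nat.lt_floor_add_one (rr μ)
    have hsum : ∑ n, kk μ * μ n = rr μ := by rw [rr, pp, Finset.mul_sum]
    suffices h : ⌊kk μ⌋₊ + 1 + 2 ≤ ⌊rr μ⌋₊ ∧
        ENNReal.ofReal (1 - (rr μ - ⌊rr μ⌋₊)) *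
            ENNReal.ofReal (codeCost (⌊kk μ⌋₊ + 1) ⌊rr μ⌋₊) +
          ENNReal.ofReal (rr μ - ⌊rr μ⌋₊) *
            ENNReal.ofReal (codeCost (⌊kk μ⌋₊ + 1) (⌊rr μ⌋₊ + 1)) ≤ C₂ μ by
      refine ⟨⌊kk μ⌋₊ + 1, Nat.succ_pos _, le_rfl, fun n => kk μ * μ n,
        fun n => mul_nonneg hk0.le (hμ0 n), kk_mul_le_one hμpos, fun n => ?_,
        fun n => S.mul_mem (kk_mem hS hμpos) (hS n), ⌊rr μ⌋₊, h.1, ?_⟩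
      · push_cast
        exact mul_le_mul_of_nonneg_right (Nat.lt_floor_add_one _).le (hμ0 n)
      · rw [hsum]
        exact ⟨hR, hR'.le, hlift _ _ _ _ (by linarith) (by linarith) hC h.2⟩
    have hkc : ⌈kk μ⌉₊ = ⌊kk μ⌋₊ ∨ ⌈kk μ⌉₊ = ⌊kk μ⌋₊ + 1 :=
      (ceil_eq_or _ hk0.le).imp And.left And.left
    have hrc : ⌈rr μ⌉₊ = ⌊rr μ⌋₊ ∨ ⌈rr μ⌉₊ = ⌊rr μ⌋₊ + 1 :=
      (ceil_eq_or _ hr0).imp And.left And.left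
    by_cases hodd : OddCase μ
    · have hlt : ⌊kk μ⌋₊ + 3 ≤ ⌊rr μ⌋₊ := by
        by_contra! hlt
        obtain ⟨j, hj⟩ := hodd
        refine hC (top_le_iff.mp (le_C₂ ?_ ?_ ?_ ?_)) <;> rw [CT_of_lt (by omega)]
      obtain ⟨l, hl⟩ : ∃ l, ⌊rr μ⌋₊ = ⌊kk μ⌋₊ + 2 * (l + 1) + 1 := by
        obtain ⟨j, hj⟩ := hodd
        exact ⟨(j - 1).toNat, by omega⟩
      refine ⟨by omega, ?_⟩
      have heq : codeCost (⌊kk μ⌋₊ + 1) (⌊rr μ⌋₊ + 1) = codeCost (⌊kk μ⌋₊ + 1) ⌊rr μ⌋₊ := by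
        rw [hl, show ⌊kk μ⌋₊ + 2 * (l + 1) + 1 = ⌊kk μ⌋₊ + 1 + 2 * (l + 1) by ring,
          codeCost_add_two_mul_add_one, codeCost_add_two_mul]
      rw [heq, ← add_mul, ← ENNReal.ofReal_add (by linarith) (by linarith), sub_add_cancel,
        ENNReal.ofReal_one, one_mul]
      exact le_C₂ (codeCost_succ_le_CT_of_odd hl (Or.inl rfl) (Or.inl rfl))
        (codeCost_succ_le_CT_of_odd hl (Or.inl rfl) hrc)
        (codeCost_succ_le_CT_of_odd hl hkc (Or.inl rfl))
        (codeCost_succ_le_CT_of_odd hl hkc hrc)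
    · have hδ : deltaW μ = 1 := if_neg hodd
      have hw₂ := ENNReal.ofReal_le_ofReal (alphaW_mul_le hμ0 hμ1 hμpos hodd)
      have hw := one_le_ofReal_weights (alphaW μ) (betaW μ) (deltaW μ)
      rw [hδ, sub_self, mul_zero, ENNReal.ofReal_zero, add_zero] at hw
      have hC₂' : C₂ μ = ENNReal.ofReal (alphaW μ * betaW μ) * CT ⌊kk μ⌋₊ ⌊rr μ⌋₊ +
          ENNReal.ofReal (alphaW μ * (1 - betaW μ)) * CT ⌊kk μ⌋₊ ⌈rr μ⌉₊ +
          ENNReal.ofReal ((1 - alphaW μ) * 1) * CT ⌈kk μ⌉₊ ⌊rr μ⌋₊ := by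
        unfold C₂
        rw [hδ, sub_self, mul_zero, ENNReal.ofReal_zero, zero_mul, add_zero]
      have key : ∀ c₁ c₂ : ℝ≥0∞, c₂ ≤ c₁ → c₁ ≤ CT ⌊kk μ⌋₊ ⌊rr μ⌋₊ → c₁ ≤ CT ⌈kk μ⌉₊ ⌊rr μ⌋₊ →
          c₂ ≤ CT ⌊kk μ⌋₊ ⌈rr μ⌉₊ → ENNReal.ofReal (1 - (rr μ - ⌊rr μ⌋₊)) * c₁ +
            ENNReal.ofReal (rr μ - ⌊rr μ⌋₊) * c₂ ≤ C₂ μ := by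
        intro c₁ c₂ h h₁ h₃ h₂
        rw [hC₂']
        refine (interpolation_le (by linarith) (by linarith) hw hw₂ h).trans ?_
        gcongr
      have hpar : Even ((⌊rr μ⌋₊ : ℤ) - ⌊kk μ⌋₊) := Int.not_odd_iff_even.mp hodd
      have hlt : ⌊kk μ⌋₊ + 3 ≤ ⌊rr μ⌋₊ := by
        by_contra! hlt
        have h := key ⊤ 0 (zero_le) (by rw [CT_of_lt hlt]) (by rw [CT_of_lt (by omega)])
          (zero_le)
        rw [ENNReal.mul_top, mul_zero, add_zero] at h
        · exact hC (top_le_iff.mp h)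
        · rw [Ne, ENNReal.ofReal_eq_zero]
          linarith
      obtain ⟨l, hl⟩ : ∃ l, ⌊rr μ⌋₊ = ⌊kk μ⌋₊ + 2 * (l + 2) := by
        obtain ⟨j, hj⟩ := hpar
        exact ⟨(j - 2).toNat, by omega⟩
      refine ⟨by omega, key _ _ (ENNReal.ofReal_le_ofReal (codeCost_succ_le (by omega)))
        (codeCost_succ_le_CT_of_even hl (Or.inl rfl)) (codeCost_succ_le_CT_of_even hl hkc) ?_⟩
      rcases hrc with h | h
      · rw [h]
        exact (ENNReal.ofReal_le_ofReal (codeCost_succ_le (by omega))).trans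
          (codeCost_succ_le_CT_of_even hl (Or.inl rfl))
      · rw [h]
        exact codeCost_succ_succ_le_CT_of_even hl

section Rationality

variable {S : Subfield ℝ}

theorem toReal_ofReal_mem {x : ℝ} (hx : x ∈ S) : (ENNReal.ofReal x).toReal ∈ S := by
  rcases le_total 0 x with h | h
  · rwa [ENNReal.toReal_ofReal h]
  · rw [ENNReal.ofReal_of_nonpos h]
    exact S.zero_mem

theorem toReal_CT_mem (a b : ℕ) : (CT a b).toReal ∈ S := by
  have hn : ∀ n : ℕ, (n : ℝ) ∈ S := fun n => natCast_mem S n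
  unfold CT
  split_ifs
  · refine toReal_ofReal_mem (S.div_mem (S.mul_mem ?_ (hn b))
      (S.sub_mem (S.sub_mem (hn b) (hn a)) S.one_mem))
    exact_mod_cast hn 4
  · refine toReal_ofReal_mem (S.div_mem (S.sub_mem (S.mul_mem ?_ (hn b)) ?_)
      (S.sub_mem (S.sub_mem (hn b) (hn a)) ?_))
    · exact_mod_cast hn 4
    · exact_mod_cast hn 2
    · exact_mod_cast hn 2
  · exact S.zero_mem

theorem toReal_add_mem {x y : ℝ≥0∞} (h : x + y ≠ ⊤) (hx : x.toReal ∈ S) (hy : y.toReal ∈ S) :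
    (x + y).toReal ∈ S := by
  rw [ENNReal.add_ne_top] at h
  rw [ENNReal.toReal_add h.1 h.2]
  exact S.add_mem hx hy

theorem toReal_ofReal_mul_CT_mem {x : ℝ} (hx : x ∈ S) (a b : ℕ) :
    (ENNReal.ofReal x * CT a b).toReal ∈ S := by
  rw [ENNReal.toReal_mul]
  exact S.mul_mem (toReal_ofReal_mem hx) (toReal_CT_mem a b)

/-- The cost `C` belongs to every field that contains the storage sizes; in particular it is
rational if they are. -/
theorem toReal_Cmin_mem (hS : ∀ n, μ n ∈ S) (hμpos : ∃ n, 0 < μ n) (hC : Cmin μ ≠ ⊤) :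
    (Cmin μ).toReal ∈ S := by
  have hn : ∀ n : ℕ, (n : ℝ) ∈ S := fun n => natCast_mem S n
  have hk := kk_mem hS hμpos
  have hp : pp μ ∈ S := S.sum_mem fun n _ => hS n
  have hr : rr μ ∈ S := S.mul_mem hk hp
  have hs : ss μ ∈ S := S.mul_mem (hn _) hp
  have h1 := S.one_mem
  have hα : alphaW μ ∈ S := by
    unfold alphaW
    split_ifs <;> repeat' first
      | assumption | exact hn _ | apply S.div_mem | apply S.mul_mem | apply S.sub_mem
  have hβ : betaW μ ∈ S := by
    unfold betaW
    split_ifs <;> repeat' first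
      | assumption | exact hn _ | exact S.zero_mem | apply S.div_mem | apply S.sub_mem
  have hδ : deltaW μ ∈ S := by
    unfold deltaW
    split_ifs <;> repeat' first
      | assumption | exact hn _ | exact S.zero_mem | apply S.div_mem | apply S.sub_mem
  rcases min_cases (C₁ μ) (C₂ μ) with ⟨h, -⟩ | ⟨h, -⟩
  · change Cmin μ = _ at h
    rw [h] at hC ⊢
    exact toReal_add_mem hC
      (toReal_ofReal_mul_CT_mem (S.sub_mem h1 (S.sub_mem hs (hn _))) _ _)
      (toReal_ofReal_mul_CT_mem (S.sub_mem hs (hn _)) _ _)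
  · change Cmin μ = _ at h
    rw [h] at hC ⊢
    have hC' := (ENNReal.add_ne_top.mp hC).1
    exact toReal_add_mem hC
      (toReal_add_mem hC' (toReal_add_mem (ENNReal.add_ne_top.mp hC').1
        (toReal_ofReal_mul_CT_mem (S.mul_mem hα hβ) _ _)
        (toReal_ofReal_mul_CT_mem (S.mul_mem hα (S.sub_mem h1 hβ)) _ _))
        (toReal_ofReal_mul_CT_mem (S.mul_mem (S.sub_mem h1 hα) hδ) _ _))
      (toReal_ofReal_mul_CT_mem (S.mul_mem (S.sub_mem h1 hα) (S.sub_mem h1 hδ)) _ _)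

end Rationality
end Params
end PRUW

end

namespace PRUW

/-! ### Time sharing between codes -/

/-- A scheme that uses `t i` parts on the set `B i` of databases for every `i`, with contents of
any sufficient lengths and any sufficient number `T` of symbols sent in a round. -/
theorem exists_scheme_of_counts {F : Type*} [Field F] [Fintype F] {N a : ℕ} (ha : 0 < a)
    (n₀ : Fin N) {I : Type*} [Fintype I] {B : I → Finset (Fin N)} {ℓ : I → ℕ}
    (hB : ∀ i, (B i).card = a + 2 * ℓ i) (hq : N + N * a ≤ Fintype.card F) {M L : ℕ}
    (t : I → ℕ) (hL : L ≤ (∑ i, t i * ℓ i) * a) (storeLen : Fin N → ℕ)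
    (hstore : ∀ n, M * ∑ i with n ∈ B i, t i * ℓ i ≤ storeLen n) (T : ℕ)
    (hT : 2 * (a * ∑ i, t i * (a + 2 * ℓ i)) ≤ T) :
    ∃ σ : Scheme F N M L, σ.IsValid ∧ σ.IsFull ∧ σ.storeLen = storeLen ∧
      σ.totalCost = (T : ℝ) / L := by
  classical
  have hsum : ∀ g : I → ℕ, ∑ p : Σ i, Fin (t i), g p.1 = ∑ i, t i * g i := fun g => by
    rw [Fintype.sum_sigma]
    simp
  have hsum' : ∀ (n : Fin N) (g : I → ℕ),
      ∑ p : Σ i, Fin (t i) with n ∈ B p.1, g p.1 = ∑ i with n ∈ B i, t i * g i := fun n g => by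
    rw [Finset.sum_filter, hsum fun i => if n ∈ B i then g i else 0, Finset.sum_filter]
    simp
  have hmsg : ∑ n, (∑ i with n ∈ B i, t i * 1) * a = a * ∑ i, t i * (a + 2 * ℓ i) := by
    rw [← Finset.sum_mul, mul_comm a]
    simp only [Finset.sum_filter]
    rw [Finset.sum_comm]
    congr 1
    refine Finset.sum_congr rfl fun i _ => ?_
    rw [← Finset.sum_filter, Finset.sum_const, ← hB i]
    simp [mul_comm]
  obtain ⟨σ, hv, hf, hs, hans, hupd⟩ := exists_scheme_of_parts (F := F) ha
    (P := Σ i, Fin (t i)) (fun p => B p.1) (fun p => ℓ p.1) (fun p => hB p.1) hq (M := M) (L := L)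
    storeLen
    (fun n => (∑ i with n ∈ B i, t i * 1) * a +
      if n = n₀ then T - 2 * (a * ∑ i, t i * (a + 2 * ℓ i)) else 0)
    (fun n => (∑ i with n ∈ B i, t i * 1) * a)
    (by rwa [hsum ℓ]) (fun n => by rw [hsum' n ℓ]; exact hstore n)
    (fun n => by rw [hsum' n fun _ => 1]; exact Nat.le_add_right _ _)
    (fun n => by rw [hsum' n fun _ => 1])
  refine ⟨σ, hv, hf, hs, ?_⟩
  unfold Scheme.totalCost Scheme.readingCost Scheme.writingCost
  rw [← add_div, hans, hupd, ← Nat.cast_sum, ← Nat.cast_sum, ← Nat.cast_add]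
  congr 2
  rw [Finset.sum_add_distrib, hmsg, Finset.sum_ite_eq' Finset.univ n₀, if_pos (Finset.mem_univ _)]
  omega

/-- The codes and their shares `w i` of the submodels: database `n` belongs to codes of total
share at most `a * μ n`, and the average cost is at most `C`. -/
theorem exists_shares {N : ℕ} {μ : Fin N → ℝ} (hμ0 : ∀ n, 0 ≤ μ n) (hμ1 : ∀ n, μ n ≤ 1)
    (hμpos : ∃ n, 0 < μ n) (hC : Cmin μ ≠ ⊤) {S : Subfield ℝ} (hS : ∀ n, μ n ∈ S) :
    ∃ a : ℕ, 0 < a ∧ a ≤ ⌊kk μ⌋₊ + 1 ∧ ∃ (I : Type) (_ : Fintype I) (B : I → Finset (Fin N))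
      (ℓ : I → ℕ) (w : I → ℝ), (∀ i, (B i).card = a + 2 * ℓ i) ∧ (∀ i, 0 < ℓ i) ∧
        (∀ i, 0 ≤ w i) ∧ (∀ i, w i ∈ S) ∧ ∑ i, w i = 1 ∧
        (∀ n, ∑ i with n ∈ B i, w i ≤ a * μ n) ∧
        ∑ i, w i * (2 * (a + 2 * ℓ i) / ℓ i) ≤ (Cmin μ).toReal := by
  classical
  obtain ⟨a, ha, ha', x, hx0, hx1, hxμ, hxS, b, hab, hb, hb', hcost⟩ :=
    exists_profile hμ0 hμ1 hμpos hC hS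
  obtain ⟨w, hw0, hwS, hw1, hwx, hwb⟩ := isMixture_of_sum_mem_Icc x hx0 hx1 hxS hb hb'
  have hcard : ∀ A : {A // w A ≠ 0}, a + 2 ≤ A.1.card := fun A => by
    rcases hwb A.1 A.2 with h | h <;> omega
  choose B hBA hB using fun A : {A // w A ≠ 0} =>
    Finset.exists_subset_card_eq (s := A.1) (n := a + 2 * ((A.1.card - a) / 2))
      (by have := hcard A; omega)
  have hsub : ∀ g : Finset (Fin N) → ℝ, ∑ A : {A // w A ≠ 0}, w A * g A = ∑ A, w A * g A := by
    intro g
    rw [← Finset.sum_subtype (Finset.univ.filter fun A => w A ≠ 0) (by simp) fun A => w A * g A]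
    refine Finset.sum_filter_of_ne fun A _ h => ?_
    exact left_ne_zero_of_mul h
  refine ⟨a, ha, ha', {A // w A ≠ 0}, inferInstance, B, fun A => (A.1.card - a) / 2,
    fun A => w A, hB, fun A => ?_, fun A => hw0 A, fun A => hwS A, ?_, fun n => ?_, ?_⟩
  · have := hcard A
    dsimp only
    omega
  · rw [← hw1]
    simpa using hsub fun _ => 1
  · refine le_trans ?_ ((hwx n).trans_le (hxμ n))
    calc ∑ A with n ∈ B A, w A.1
        ≤ ∑ A : {A // w A ≠ 0}, w A * if n ∈ A.1 then 1 else 0 := by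
          rw [Finset.sum_filter]
          refine Finset.sum_le_sum fun A _ => ?_
          by_cases h : n ∈ B A
          · simp [h, hBA A h]
          · have := hw0 A
            rw [if_neg h]
            positivity
      _ = ∑ A with n ∈ A, w A := by
          rw [hsub fun A => if n ∈ A then 1 else 0]
          simp [Finset.sum_filter]
  · refine le_trans (le_of_eq ?_) hcost
    -- On the support of `w` the cost is the affine function of the size of the set that
    -- interpolates the costs at `b` and `b + 1`, and the average size is `∑ n, x n`.
    have hsize : ∑ A, w A * (A.card : ℝ) = ∑ n, x n := by
      simp only [← hwx, Finset.sum_filter]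
      rw [Finset.sum_comm]
      refine Finset.sum_congr rfl fun A _ => ?_
      rw [← Finset.sum_filter]
      simp [mul_comm]
    calc ∑ A : {A // w A ≠ 0}, w A * (2 * (a + 2 * ((A.1.card - a) / 2 : ℕ)) /
          ((A.1.card - a) / 2 : ℕ))
        = ∑ A, w A * codeCost a A.card := hsub fun A => codeCost a A.card
      _ = ∑ A, (w A * (codeCost a b - b * (codeCost a (b + 1) - codeCost a b)) +
          w A * A.card * (codeCost a (b + 1) - codeCost a b)) := by
        refine Finset.sum_congr rfl fun A _ => ?_
        by_cases hA : w A = 0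
        · simp [hA]
        · rcases hwb A hA with h | h <;> rw [h] <;> push_cast <;> ring
      _ = _ := by
        rw [Finset.sum_add_distrib, ← Finset.sum_mul, ← Finset.sum_mul, hw1, hsize]
        ring

/-- Finitely many non-negative rational numbers have a common denominator. -/
theorem exists_common_denominator {J : Type*} [Finite J] (r : J → ℝ) (h0 : ∀ j, 0 ≤ r j)
    (h : ∀ j, r j ∈ (algebraMap ℚ ℝ).fieldRange) :
    ∃ d : ℕ, 0 < d ∧ ∀ L : ℕ, d ∣ L → ∀ j, ∃ m : ℕ, r j * L = m := by
  have := Fintype.ofFinite J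
  choose s hs using h
  refine ⟨∏ j, (s j).den, Finset.prod_pos fun j _ => (s j).den_pos, fun L hL j => ?_⟩
  obtain ⟨c, rfl⟩ := (Finset.dvd_prod_of_mem _ (Finset.mem_univ j)).trans hL
  have hsj : r j = s j := (hs j).symm
  have hs0 : 0 ≤ s j := by
    have := h0 j
    rw [hsj] at this
    exact_mod_cast this
  refine ⟨(s j).num.toNat * c, ?_⟩
  have hnum : ((s j).num.toNat : ℚ) = (s j).num := by
    exact_mod_cast Int.toNat_of_nonneg (Rat.num_nonneg.mpr hs0)
  have : s j * ((s j).den * c : ℕ) = ((s j).num.toNat * c : ℕ) := by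
    push_cast
    rw [hnum, ← mul_assoc, Rat.mul_den_eq_num]
  rw [hsj]
  exact_mod_cast this

end PRUW

open PRUW in
theorem theorem1 (N : ℕ) (μ : Fin N → ℝ)
    (hμ0 : ∀ n, 0 ≤ μ n) (hμ1 : ∀ n, μ n ≤ 1) (hμpos : ∃ n, 0 < μ n)
    (hC : PRUW.Cmin μ ≠ ⊤) :
    ∃ q₀ : ℕ,
      ((∀ n, ∃ x : ℚ, μ n = x) →
        ∃ L₀ : ℕ, 0 < L₀ ∧
          ∀ (F : Type*) [Field F] [Fintype F], q₀ ≤ Fintype.card F →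
          ∀ M L : ℕ, 0 < M → 0 < L → L₀ ∣ L →
            ∃ σ : PRUW.Scheme F N M L, σ.IsValid ∧ σ.IsFull ∧
              (∀ n, (σ.storeLen n : ℝ) = μ n * M * L) ∧
              σ.totalCost = (PRUW.Cmin μ).toReal) ∧
      (∀ ε : ℝ, 0 < ε →
        ∃ L₀ : ℕ, 0 < L₀ ∧
          ∀ (F : Type*) [Field F] [Fintype F], q₀ ≤ Fintype.card F →
          ∀ M L : ℕ, 0 < M → L₀ ≤ L →
            ∃ σ : PRUW.Scheme F N M L, σ.IsValid ∧ σ.IsFull ∧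
              (∀ n, |(σ.storeLen n : ℝ) - μ n * M * L| ≤ ε * M * L) ∧
              |σ.totalCost - (PRUW.Cmin μ).toReal| ≤ ε) := by
  classical
  obtain ⟨n₀, -⟩ := id hμpos
  have hC0 : 0 ≤ (Cmin μ).toReal := ENNReal.toReal_nonneg
  refine ⟨N + N * (⌊kk μ⌋₊ + 1), fun hrat => ?_, fun ε hε => ?_⟩
  · have hS : ∀ n, μ n ∈ (algebraMap ℚ ℝ).fieldRange := fun n => by
      obtain ⟨x, hx⟩ := hrat n
      exact ⟨x, hx.symm⟩
    obtain ⟨a, ha, ha', I, _, B, ℓ, w, hB, hℓ, hw0, hwS, hw1, hwμ, hcost⟩ :=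
      exists_shares hμ0 hμ1 hμpos hC hS
    have haR : (0 : ℝ) < a := by exact_mod_cast ha
    have hℓR : ∀ i, (0 : ℝ) < ℓ i := fun i => by exact_mod_cast hℓ i
    have hn : ∀ n : ℕ, (n : ℝ) ∈ (algebraMap ℚ ℝ).fieldRange := fun n => natCast_mem _ n
    obtain ⟨d₁, hd₁, h₁⟩ := exists_common_denominator μ hμ0 hS
    obtain ⟨d₂, hd₂, h₂⟩ := exists_common_denominator (fun i => w i / (a * ℓ i))
      (fun i => div_nonneg (hw0 i) (by positivity))
      fun i => Subfield.div_mem _ (hwS i) (Subfield.mul_mem _ (hn _) (hn _))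
    obtain ⟨d₃, hd₃, h₃⟩ := exists_common_denominator (fun _ : Unit => (Cmin μ).toReal)
      (fun _ => hC0) fun _ => toReal_Cmin_mem hS hμpos hC
    refine ⟨d₁ * d₂ * d₃, by positivity, fun F _ _ hq M L hM hL hdvd => ?_⟩
    choose m hm using h₁ L (((dvd_mul_right _ _).trans (dvd_mul_right _ _)).trans hdvd)
    choose t ht using h₂ L (((dvd_mul_left _ _).trans (dvd_mul_right _ _)).trans hdvd)
    choose T hT using h₃ L ((dvd_mul_left _ _).trans hdvd)
    have hLR : (0 : ℝ) < L := by exact_mod_cast hL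
    have htℓ : ∀ i, (t i : ℝ) * ℓ i = w i * L / a := fun i => by
      have := hℓR i
      rw [← ht i]
      field_simp
    have hcap : L ≤ (∑ i, t i * ℓ i) * a := by
      rw [← Nat.cast_le (α := ℝ)]
      push_cast
      simp only [htℓ]
      rw [← Finset.sum_div, ← Finset.sum_mul, hw1]
      field_simp
      rfl
    have hstore : ∀ n, M * ∑ i with n ∈ B i, t i * ℓ i ≤ M * m n := fun n => by
      refine Nat.mul_le_mul_left M ?_
      rw [← Nat.cast_le (α := ℝ), ← hm n]
      push_cast
      simp only [htℓ]
      rw [← Finset.sum_div, ← Finset.sum_mul, div_le_iff₀ haR]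
      calc _ ≤ a * μ n * L := mul_le_mul_of_nonneg_right (hwμ n) hLR.le
        _ = _ := by ring
    have htot : 2 * (a * ∑ i, t i * (a + 2 * ℓ i)) ≤ T () := by
      rw [← Nat.cast_le (α := ℝ), ← hT ()]
      refine le_trans (le_of_eq ?_) (mul_le_mul_of_nonneg_right hcost hLR.le)
      push_cast
      rw [Finset.sum_mul, Finset.mul_sum, Finset.mul_sum]
      refine Finset.sum_congr rfl fun i _ => ?_
      have := hℓR i
      rw [← ht i]
      field_simp
    obtain ⟨σ, hv, hf, hs, hc⟩ := exists_scheme_of_counts (F := F) ha n₀ hB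
      (le_trans (by gcongr) hq) t hcap (fun n => M * m n) hstore (T ()) htot
    refine ⟨σ, hv, hf, fun n => ?_, ?_⟩
    · rw [hs]
      push_cast
      rw [← hm n]
      ring
    · rw [hc, ← hT (), mul_div_assoc, div_self hLR.ne', mul_one]
  · obtain ⟨a, ha, ha', I, _, B, ℓ, w, hB, hℓ, hw0, hwS, hw1, hwμ, hcost⟩ :=
      exists_shares hμ0 hμ1 hμpos hC (S := ⊤) fun n => Subfield.mem_top _
    have haR : (0 : ℝ) < a := by exact_mod_cast ha
    have hℓR : ∀ i, (0 : ℝ) < ℓ i := fun i => by exact_mod_cast hℓ i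
    -- The errors that come from rounding up the number of parts of every code.
    set E : ℝ := ∑ i, (ℓ i : ℝ) with hE
    set E' : ℝ := 2 * (a * ∑ i, ((a : ℝ) + 2 * ℓ i)) with hE'
    have hE0 : 0 ≤ E := Finset.sum_nonneg fun i _ => (hℓR i).le
    have hE0' : 0 ≤ E' := by positivity
    refine ⟨⌈(E + E' + 1) / ε⌉₊, Nat.ceil_pos.mpr (by positivity),
      fun F _ _ hq M L hM hL => ?_⟩
    have hLε : E + E' + 1 ≤ ε * L := by
      have := (Nat.le_ceil ((E + E' + 1) / ε)).trans (Nat.cast_le.mpr hL)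
      rwa [div_le_iff₀ hε, mul_comm] at this
    have hLR : (0 : ℝ) < L := by
      by_contra! h
      have : ε * L ≤ 0 := mul_nonpos_of_nonneg_of_nonpos hε.le h
      linarith
    set t : I → ℕ := fun i => ⌈w i * L / (a * ℓ i)⌉₊ with ht
    have ht1 : ∀ i, w i * L / (a * ℓ i) ≤ t i := fun i => Nat.le_ceil _
    have ht2 : ∀ i, (t i : ℝ) ≤ w i * L / (a * ℓ i) + 1 := fun i =>
      (Nat.ceil_lt_add_one (by have := hw0 i; positivity)).le
    set used : Fin N → ℕ := fun n => ∑ i with n ∈ B i, t i * ℓ i with hused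
    set tot : ℕ := 2 * (a * ∑ i, t i * (a + 2 * ℓ i)) with htot
    have hused_le : ∀ n, (used n : ℝ) ≤ μ n * L + E := fun n => by
      calc (used n : ℝ) = ∑ i with n ∈ B i, (t i : ℝ) * ℓ i := by
            rw [hused]
            push_cast
            rfl
        _ ≤ ∑ i with n ∈ B i, (w i * (L / a) + ℓ i) := by
            refine Finset.sum_le_sum fun i _ => ?_
            have := hℓR i
            refine (mul_le_mul_of_nonneg_right (ht2 i) this.le).trans_eq ?_
            field_simp
        _ ≤ a * μ n * (L / a) + E := by
            rw [Finset.sum_add_distrib, ← Finset.sum_mul]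
            refine add_le_add (mul_le_mul_of_nonneg_right (hwμ n) (by positivity)) ?_
            exact Finset.sum_le_sum_of_subset_of_nonneg (Finset.filter_subset _ _)
              fun i _ _ => (hℓR i).le
        _ = μ n * L + E := by field_simp
    have htot_le : (tot : ℝ) ≤ (Cmin μ).toReal * L + E' := by
      calc (tot : ℝ) = 2 * (a * ∑ i, (t i : ℝ) * (a + 2 * ℓ i)) := by
            rw [htot]
            push_cast
            rfl
        _ ≤ 2 * (a * ∑ i, (w i * L / (a * ℓ i) + 1) * (a + 2 * ℓ i)) := by
            gcongr with i
            exact ht2 i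
        _ = (∑ i, w i * (2 * (a + 2 * ℓ i) / ℓ i)) * L + E' := by
            rw [hE', Finset.sum_mul, Finset.mul_sum, Finset.mul_sum, Finset.mul_sum,
              Finset.mul_sum, ← Finset.sum_add_distrib]
            refine Finset.sum_congr rfl fun i _ => ?_
            have := hℓR i
            field_simp
        _ ≤ _ := by gcongr
    have hcap : L ≤ (∑ i, t i * ℓ i) * a := by
      rw [← Nat.cast_le (α := ℝ)]
      push_cast
      rw [Finset.sum_mul]
      calc (L : ℝ) = ∑ i, w i * L := by rw [← Finset.sum_mul, hw1, one_mul]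
        _ ≤ ∑ i, (t i : ℝ) * ℓ i * a := by
            refine Finset.sum_le_sum fun i _ => ?_
            have := hℓR i
            have h := ht1 i
            rw [div_le_iff₀ (by positivity)] at h
            linarith
    obtain ⟨σ, hv, hf, hs, hc⟩ := exists_scheme_of_counts (F := F) ha n₀ hB
      (le_trans (by gcongr) hq) t hcap (fun n => M * max (used n) ⌊μ n * L⌋₊)
      (fun n => Nat.mul_le_mul_left M (le_max_left _ _)) (max tot ⌊(Cmin μ).toReal * L⌋₊)
      (le_max_left _ _)
    -- Both maxima differ from the exact values by at most the rounding errors.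
    have hmax : ∀ (y e : ℝ) (c : ℕ), 0 ≤ y → 0 ≤ e → (c : ℝ) ≤ y + e →
        |((max c ⌊y⌋₊ : ℕ) : ℝ) - y| ≤ e + 1 := by
      intro y e c hy he hc
      rw [abs_le, Nat.cast_max]
      have h1 := Nat.floor_le hy
      have h2 := Nat.lt_floor_add_one y
      constructor
      · have := le_max_right (c : ℝ) (⌊y⌋₊ : ℝ)
        linarith
      · have := max_le (a := (c : ℝ)) (b := (⌊y⌋₊ : ℝ)) (c := y + e) hc (by linarith)
        linarith
    refine ⟨σ, hv, hf, fun n => ?_, ?_⟩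
    · rw [hs]
      push_cast [-Nat.cast_max]
      have h := hmax (μ n * L) E (used n) (mul_nonneg (hμ0 n) hLR.le) hE0 (hused_le n)
      have hMR : (0 : ℝ) ≤ M := Nat.cast_nonneg M
      calc _ = |(M : ℝ) * (((max (used n) ⌊μ n * L⌋₊ : ℕ) : ℝ) - μ n * L)| := by
            congr 1
            ring
        _ ≤ M * (E + 1) := by
            rw [abs_mul, abs_of_nonneg hMR]
            gcongr
        _ ≤ M * (ε * L) := by
            gcongr
            linarith
        _ = _ := by ring
    · rw [hc]
      have h := hmax ((Cmin μ).toReal * L) E' tot (by positivity) hE0' htot_le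
      have heq : ((max tot ⌊(Cmin μ).toReal * L⌋₊ : ℕ) : ℝ) / L - (Cmin μ).toReal =
          (((max tot ⌊(Cmin μ).toReal * L⌋₊ : ℕ) : ℝ) - (Cmin μ).toReal * L) / L := by
        field_simp
      rw [heq, abs_div, abs_of_pos hLR, div_le_iff₀ hLR]
      linarith
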